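/- Let $\mathcal N=\omega^\omega$ be the Baire space. A qcb$_0$-space is a $T_0$-space that is a topological quotient of a countably based space; $\mathsf{QCB}_0$ is the category of qcb$_0$-spaces and continuous functions. For an arbitrary topological space $X$ let $\mathbf\Sigma^1_0(X)$ be the class of countable unions of differences of open subsets of $X$; let $\mathbf\Sigma^1_{\alpha+1}(X)$ be the class of projections along $\mathcal N$ of complements of sets in $\mathbf\Sigma^1_\alpha(\mathcal N\times X)$; and, for a limit ordinal $\lambda$, let $\mathbf\Sigma^1_\lambda(X)$ be the class of projections along $\mathcal N$ of countable intersections of sets in $\bigcup_{\alpha<\lambda}\mathbf\Sigma^1_\alpha(\mathcal N\times X)$. An admissible representation of $X$ is a continuous surjection $\delta\colon D\to X$ with $D\subseteq\mathcal N$ such that, for every $Z\subseteq\mathcal N$, every continuous $\nu\colon Z\to X$ is of the form $\delta\circ g$ with $g\colon Z\to D$ continuous. Let $\mathsf{QCB}_0(\mathbf{HP})$ be the full subcategory of $\mathsf{QCB}_0$ of those qcb$_0$-spaces that have, for some $\alpha<\omega_1$, an admissible representation $\delta\colon D\to X$ with $\{(p,q)\in D\times D : \delta(p)=\delta(q)\}\in\mathbf\Sigma^1_\alpha(\mathcal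 N^2)$. Say that a full subcategory $\mathsf C$ of $\mathsf{QCB}_0$ inherits exponentials, countable limits and countable colimits from $\mathsf{QCB}_0$ if any two objects $X,Y$ of $\mathsf C$ have an exponential $Y^X$ in $\mathsf{QCB}_0$ that is an object of $\mathsf C$, and every countable diagram of objects of $\mathsf C$ has a limit and a colimit in $\mathsf{QCB}_0$ that are objects of $\mathsf C$. Say that $\mathsf C$ contains the Sierpinski space if some object of $\mathsf C$ is homeomorphic to it. **Theorem.** The category $\mathsf{QCB}_0(\mathbf{HP})$ is, up to homeomorphism, the smallest full subcategory of $\mathsf{QCB}_0$ that contains the Sierpinski space and inherits exponentials, countable limits and countable colimits from $\mathsf{QCB}_0$. That is: 1. $\mathsf{QCB}_0(\mathbf{HP})$ contains the Sierpinski space and inherits exponentials, countable limits and countable colimits from $\mathsf{QCB}_0$; 2. if $\mathsf C$ is any full subcategory of $\mathsf{QCB}_0$ that contains the Sierpinski space and inherits exponentials, countable limits and countable colimits from $\mathsf{QCB}_0$, then every object of $\mathsf{QCB}_0(\mathbf{HP})$ is homeomorphic to an object of $\mathsf C$. -/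

import Mathlib

open CategoryTheory CategoryTheory.Limits

universe u v w

noncomputable section

namespace HyperprojectiveQCB

/-! ### Pointclasses and the hyperprojective hierarchy -/

/-- The Baire space (with the product of the discrete topologies). -/
abbrev Baire : Type := ℕ → ℕ

/-- An assignment to every topological space of a collection of subsets of it. -/
abbrev PointclassFamily : Type 1 := (X : Type) → [TopologicalSpace X] → Set (Set X)

namespace PointclassFamily

/-- `Γ_c`: all complements of sets in `Γ(X)`. -/
def compl (Γ : PointclassFamily) : PointclassFamily :=
  fun X _ => {A | ∃ B ∈ Γ X, A = Bᶜ}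

/-- `Γ_d`: all differences of sets in `Γ(X)`. -/
def diff (Γ : PointclassFamily) : PointclassFamily :=
  fun X _ => {A | ∃ B ∈ Γ X, ∃ C ∈ Γ X, A = B \ C}

/-- `Γ_σ`: all countable unions of sets in `Γ(X)`. -/
def sigma (Γ : PointclassFamily) : PointclassFamily :=
  fun X _ => {A | ∃ B : ℕ → Set X, (∀ n, B n ∈ Γ X) ∧ A = ⋃ n, B n}

/-- `Γ_δ`: all countable intersections of sets in `Γ(X)`. -/
def delta (Γ : PointclassFamily) : PointclassFamily :=
  fun X _ => {A | ∃ B : ℕ → Set X, (∀ n, B n ∈ Γ X) ∧ A = ⋂ n, B n}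

/-- `Γ_∃`: all projections to `X` of sets in `Γ(𝓝 × X)`, where `𝓝` is the Baire space. -/
def proj (Γ : PointclassFamily) : PointclassFamily :=
  fun X _ => {A | ∃ B ∈ Γ (Baire × X), A = {x | ∃ p : Baire, (p, x) ∈ B}}

/-- The family of topologies. -/
def opens : PointclassFamily := fun X _ => {A | IsOpen A}

/-- `Σ¹_α` for every ordinal `α`: `Σ¹_0 = Σ⁰_2` (countable unions of differences of open sets),
`Σ¹_{α+1} = (Σ¹_α)_{c∃}`, and `Σ¹_γ = (⋃_{α<γ} Σ¹_α)_{δ∃}` for limit ordinals `γ`. -/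
def sigmaOne (α : Ordinal.{0}) : PointclassFamily :=
  Ordinal.limitRecOn α
    opens.diff.sigma
    (fun _ Γ => Γ.compl.proj)
    (fun γ _ Γ => (PointclassFamily.delta
      (fun _ _ => {A | ∃ (β : Ordinal.{0}) (h : β < γ), A ∈ Γ β h _})).proj)

end PointclassFamily

/-! ### Admissible representations -/

/-- `δ`, a function defined on the subspace `D` of the Baire space, is an admissible
representation of `X`: a continuous surjection onto `X` such that every continuous `ν : Z → X`
defined on a subspace `Z` of the Baire space factors continuously through `δ`. -/
structure IsAdmissible {X : Type u} [TopologicalSpace X] {D : Set Baire} (δ : D → X) : Prop where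
  surjective : Function.Surjective δ
  continuous : Continuous δ
  factors : ∀ (Z : Set Baire) (ν : Z → X), Continuous ν →
    ∃ g : Z → D, Continuous g ∧ ∀ z, ν z = δ (g z)

/-- `EQ(δ)`: the pairs of names of the same point. -/
def EQ {X : Type u} {D : Set Baire} (δ : D → X) : Set (Baire × Baire) :=
  {r | ∃ (hp : r.1 ∈ D) (hq : r.2 ∈ D), δ ⟨r.1, hp⟩ = δ ⟨r.2, hq⟩}

/-- `X` is `Γ`-representable. -/
def IsRepresentable (Γ : PointclassFamily) (X : Type u) [TopologicalSpace X] : Prop :=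
  ∃ (D : Set Baire) (δ : D → X), IsAdmissible δ ∧ EQ δ ∈ Γ (Baire × Baire)

/-! ### The category of qcb₀-spaces and its full subcategories -/

/-- `X` is a qcb₀-space: a `T₀`-space that is a topological quotient of a countably based
space. -/
def IsQCB0 : ObjectProperty TopCat.{u} := fun X =>
  T0Space X ∧ ∃ (Z : TopCat.{u}) (q : Z → X), SecondCountableTopology Z ∧ Topology.IsQuotientMap q

/-- The category of qcb₀-spaces and continuous functions. -/
abbrev QCB0 : Type (u + 1) := IsQCB0.{u}.FullSubcategory

/-- The hyperprojective qcb₀-spaces, as a full subcategory of `QCB0`: the qcb₀-spaces that are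
`Σ¹_α`-representable for some countable ordinal `α`. -/
def HP : ObjectProperty QCB0.{u} := fun X =>
  ∃ α < Ordinal.omega.{0} 1, IsRepresentable (PointclassFamily.sigmaOne α) X.obj

/-- `E`, with some evaluation morphism `ev : E × X ⟶ Y`, is an exponential `Y^X` in the category
`C`: every `g : Z × X ⟶ Y` is `ev ∘ (h × id)` for exactly one `h : Z ⟶ E`. Here the products are
arbitrary product cones, and `k` is the morphism `h × id`. -/
def IsExponential {C : Type v} [Category.{w} C] (X Y E : C) : Prop :=
  ∃ (P : BinaryFan E X) (_ : Nonempty (IsLimit P)) (ev : P.pt ⟶ Y),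
    ∀ (Z : C) (Q : BinaryFan Z X), Nonempty (IsLimit Q) → ∀ g : Q.pt ⟶ Y,
      ∃! h : Z ⟶ E, ∃ k : Q.pt ⟶ P.pt, k ≫ P.fst = Q.fst ≫ h ∧ k ≫ P.snd = Q.snd ∧ k ≫ ev = g

/-- The full subcategory `S` contains (a homeomorphic copy of) the Sierpinski space, which is
`Prop` with the topology in which `{True}` is open but `{False}` is not. -/
def ContainsSierpinski (S : ObjectProperty QCB0.{u}) : Prop :=
  ∃ X : QCB0.{u}, S X ∧ Nonempty (X.obj ≃ₜ Prop)

/-- The full subcategory `S` of `QCB0` inherits exponentials, countable limits and countable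
colimits from `QCB0`: for objects in `S`, there is an exponential in `QCB0` that belongs to `S`,
and for a countable diagram with objects in `S`, there are a limit in `QCB0` and a colimit in
`QCB0` that belong to `S`. -/
structure InheritsStructure (S : ObjectProperty QCB0.{u}) : Prop where
  exponentials : ∀ X Y : QCB0.{u}, S X → S Y → ∃ E : QCB0.{u}, S E ∧ IsExponential X Y E
  limits : ∀ (J : Type) [SmallCategory J] [CountableCategory J] (F : J ⥤ QCB0.{u}),
    (∀ j, S (F.obj j)) → ∃ c : Cone F, Nonempty (IsLimit c) ∧ S c.pt
  colimits : ∀ (J : Type) [SmallCategory J] [CountableCategory J] (F : J ⥤ QCB0.{u}),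
    (∀ j, S (F.obj j)) → ∃ c : Cocone F, Nonempty (IsColimit c) ∧ S c.pt

end HyperprojectiveQCB

end

noncomputable section

namespace HyperprojectiveQCB

open Topology Filter Set

/-! ### Hyperprojective sets -/

section Hyp

open PointclassFamily

/-! Closure of `HP`. Hyperprojective sets are stable under continuous preimages, countable Boolean
operations and quantification over the Baire space. It therefore suffices to build, for each
construction, an admissible representation whose domain and name equality are written with such
quantifiers from those of the given spaces. In a limit, a name merges names of the coordinates
(`exists_limit`). In an exponential, a name codes an open set describing the graph of a realizer
(`exists_exponential`). In a colimit, a name codes the neighbourhood filter of a point, as an open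
set of codes of open sets (`exists_isAdmissible_of_quotient`). All spaces involved are sequential
and convergent sequences are images of sequences in the Baire space, so continuity can be tested on
maps out of the Baire space.

Minimality. Let `S` have the closure properties. It contains copies of the point, of the natural
numbers and of the Baire space. Inside a second countable Hausdorff space with a copy in `S`, open
sets are equalizers of maps to the Sierpinski space. The image of a map is the equalizer of its
cokernel pair (`HasCopy.range`). The complement of `A` is the equalizer of two maps into the
exponential of the Sierpinski space by `A` (`HasCopy.compl`). Induction over the hierarchy gives
copies of all its sets (`HasCopy.of_mem_sigmaOne`), in particular of `EQ δ` and its projection `D`,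
and a represented space is the coequalizer of the two projections from `EQ δ` to `D`
(`HasCopy.of_HP`). -/

lemma sigmaOne_zero : sigmaOne 0 = opens.diff.sigma :=
  Ordinal.limitRecOn_zero ..

lemma sigmaOne_add_one (α : Ordinal.{0}) : sigmaOne (α + 1) = (sigmaOne α).compl.proj :=
  Ordinal.limitRecOn_add_one ..

lemma sigmaOne_limit {γ : Ordinal.{0}} (h : Order.IsSuccLimit γ) :
    sigmaOne γ = (PointclassFamily.delta
      (fun X _ => {A | ∃ β < γ, A ∈ sigmaOne β X})).proj := by
  have := Ordinal.limitRecOn_limit (motive := fun _ => PointclassFamily) γ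
    opens.diff.sigma (fun _ Γ => Γ.compl.proj)
    (fun γ _ Γ => (PointclassFamily.delta
      (fun _ _ => {A | ∃ (β : Ordinal.{0}) (h : β < γ), A ∈ Γ β h _})).proj) h
  refine this.trans ?_
  simp only [exists_prop]
  rfl

variable {X Y : Type} [TopologicalSpace X] [TopologicalSpace Y]

lemma sigmaOne_preimage (α : Ordinal.{0}) :
    ∀ {X Y : Type} [TopologicalSpace X] [TopologicalSpace Y] {f : X → Y}, Continuous f →
      ∀ {A : Set Y}, A ∈ sigmaOne α Y → f ⁻¹' A ∈ sigmaOne α X := by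
  induction α using Ordinal.limitRecOn with
  | zero =>
    intro X Y _ _ f hf A hA
    rw [sigmaOne_zero] at hA ⊢
    obtain ⟨B, hB, rfl⟩ := hA
    refine ⟨fun n => f ⁻¹' B n, fun n => ?_, by simp⟩
    obtain ⟨U, hU, V, hV, h⟩ := hB n
    exact ⟨f ⁻¹' U, IsOpen.preimage hf hU, f ⁻¹' V, IsOpen.preimage hf hV, by simp [h]⟩
  | add_one α ih =>
    intro X Y _ _ f hf A hA
    rw [sigmaOne_add_one] at hA ⊢
    obtain ⟨_, ⟨C, hC, rfl⟩, rfl⟩ := hA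
    exact ⟨_, ⟨_, ih (f := Prod.map id f) (continuous_id.prodMap hf) hC, rfl⟩, by ext; simp⟩
  | limit γ hγ ih =>
    intro X Y _ _ f hf A hA
    rw [sigmaOne_limit hγ] at hA ⊢
    obtain ⟨_, ⟨C, hC, rfl⟩, rfl⟩ := hA
    refine ⟨_, ⟨fun n => Prod.map id f ⁻¹' C n, fun n => ?_, rfl⟩, by ext; simp⟩
    obtain ⟨β, hβ, h⟩ := hC n
    exact ⟨β, hβ, ih β hβ (continuous_id.prodMap hf) h⟩

/-- A set is hyperprojective if it belongs to `Σ¹_α` for some countable ordinal `α`. -/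
def Hyp (A : Set X) : Prop :=
  ∃ α < Ordinal.omega.{0} 1, A ∈ sigmaOne α X

namespace Hyp

lemma _root_.IsOpen.hyp {A : Set X} (hA : IsOpen A) : Hyp A := by
  refine ⟨0, Ordinal.omega_pos 1, ?_⟩
  rw [sigmaOne_zero]
  exact ⟨fun _ => A, fun _ => ⟨A, hA, ∅, isOpen_empty, by simp⟩, by simp [iUnion_const]⟩

lemma preimage {A : Set Y} (hA : Hyp A) {f : X → Y} (hf : Continuous f) : Hyp (f ⁻¹' A) := by
  obtain ⟨α, hα, h⟩ := hA
  exact ⟨α, hα, sigmaOne_preimage α hf h⟩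

lemma add_one_lt_omega_one {α : Ordinal.{0}} (h : α < Ordinal.omega.{0} 1) :
    α + 1 < Ordinal.omega.{0} 1 :=
  (Cardinal.isSuccLimit_omega 1).add_one_lt h

/-- The successor step contains a complementation; the projection that comes with it is taken along
a dummy Baire coordinate. -/
lemma not {P : X → Prop} (hP : Hyp {x | P x}) : Hyp {x | ¬ P x} := by
  obtain ⟨α, hα, h⟩ := hP
  refine ⟨α + 1, add_one_lt_omega_one hα, ?_⟩
  rw [sigmaOne_add_one]
  exact ⟨_, ⟨_, sigmaOne_preimage α (f := Prod.snd (α := Baire)) continuous_snd h, rfl⟩,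
    by ext; simp⟩

lemma existsBaire {P : Baire → X → Prop} (hP : Hyp {z : Baire × X | P z.1 z.2}) :
    Hyp {x | ∃ p, P p x} := by
  -- The successor step projects complements, so it has to be fed the negation.
  obtain ⟨α, hα, h⟩ := hP.not
  refine ⟨α + 1, add_one_lt_omega_one hα, ?_⟩
  rw [sigmaOne_add_one]
  exact ⟨_, ⟨_, h, rfl⟩, by ext; simp⟩

lemma forallBaire {P : Baire → X → Prop} (hP : Hyp {z : Baire × X | P z.1 z.2}) :
    Hyp {x | ∀ p, P p x} := by
  have := (existsBaire (P := fun p x => ¬ P p x) hP.not).not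
  simpa using this

/-- Countable intersections are available at limit stages. The supremum of the given levels is
countable, and adding `ω` yields a countable limit ordinal strictly above all of them. -/
lemma forallNat {P : ℕ → X → Prop} (hP : ∀ n, Hyp {x | P n x}) : Hyp {x | ∀ n, P n x} := by
  choose α hα h using hP
  have h1 : (⨆ n, α n) < Ordinal.omega.{0} 1 := Ordinal.iSup_lt_omega_one hα
  have hlim : Order.IsSuccLimit ((⨆ n, α n) + Ordinal.omega0) :=
    Ordinal.isSuccLimit_add _ Ordinal.isSuccLimit_omega0
  refine ⟨(⨆ n, α n) + Ordinal.omega0, ?_, ?_⟩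
  · exact Ordinal.isPrincipal_add_omega 1 h1 Ordinal.omega0_lt_omega_one
  · rw [sigmaOne_limit hlim]
    refine ⟨_, ⟨fun n => Prod.snd ⁻¹' {x | P n x}, fun n => ⟨α n, ?_,
      sigmaOne_preimage _ continuous_snd (h n)⟩, rfl⟩, by ext; simp⟩
    exact (Ordinal.le_iSup α n).trans_lt (lt_add_of_pos_right _ Ordinal.omega0_pos)

lemma const (P : Prop) : Hyp {_x : X | P} := IsOpen.hyp isOpen_const

lemma forallCountable {ι : Type*} [Countable ι] {P : ι → X → Prop} (hP : ∀ i, Hyp {x | P i x}) :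
    Hyp {x | ∀ i, P i x} := by
  rcases isEmpty_or_nonempty ι with h | h
  · simpa using const (X := X) True
  · obtain ⟨e, he⟩ := exists_surjective_nat ι
    have := forallNat (fun n => hP (e n))
    simpa [he.forall] using this

lemma existsCountable {ι : Type*} [Countable ι] {P : ι → X → Prop} (hP : ∀ i, Hyp {x | P i x}) :
    Hyp {x | ∃ i, P i x} := by
  have := (forallCountable (fun i => (hP i).not)).not
  simpa using this

lemma and {P Q : X → Prop} (hP : Hyp {x | P x}) (hQ : Hyp {x | Q x}) : Hyp {x | P x ∧ Q x} := by
  have := forallCountable (ι := Bool) (P := fun b x => cond b (P x) (Q x))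
    (by rintro (_ | _); exacts [hQ, hP])
  simpa [and_comm] using this

lemma imp {P Q : X → Prop} (hP : Hyp {x | P x}) (hQ : Hyp {x | Q x}) :
    Hyp {x | P x → Q x} := by
  have := (hP.and hQ.not).not
  simpa using this

lemma iff {P Q : X → Prop} (hP : Hyp {x | P x}) (hQ : Hyp {x | Q x}) :
    Hyp {x | P x ↔ Q x} := by
  have := (hP.imp hQ).and (hQ.imp hP)
  simpa [iff_iff_implies_and_implies] using this

end Hyp

end Hyp

/-! ### Coding of open sets -/

section OpenCode

open Classical in
/-- Every point `p` of the Baire space codes the open set `{t | (p, t) ∈ openCode B}` of the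
second countable space `B`. -/
def openCode (B : Type*) [TopologicalSpace B] [SecondCountableTopology B] : Set (Baire × B) :=
  {z | ∃ (m : ℕ) (s : TopologicalSpace.countableBasis B),
    z.1 (Nat.pair m (Encodable.encode s)) ≠ 0 ∧ z.2 ∈ s.1}

variable {B : Type*} [TopologicalSpace B] [SecondCountableTopology B]

lemma isOpen_openCode : IsOpen (openCode B) := by
  have : openCode B = ⋃ (m : ℕ) (s : TopologicalSpace.countableBasis B),
      {z : Baire × B | z.1 (Nat.pair m (Encodable.encode s)) ≠ 0} ∩ Prod.snd ⁻¹' s.1 := by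
    ext; simp [openCode]
  rw [this]
  refine isOpen_iUnion fun m => isOpen_iUnion fun s => IsOpen.inter ?_ ?_
  · exact (isOpen_discrete {n : ℕ | n ≠ 0}).preimage
      (f := fun z : Baire × B => z.1 (Nat.pair m (Encodable.encode s))) (by fun_prop)
  · exact (TopologicalSpace.isOpen_of_mem_countableBasis s.2).preimage continuous_snd

open Classical in
/-- An open set of pairs yields a continuous choice of codes of its sections. -/
lemma exists_openCode {Z : Set Baire} {T : Set B} {O : Set (Z × T)} (hO : IsOpen O) :
    ∃ c : Z → Baire, Continuous c ∧
      ∀ (z : Z) (t : T), (c z, (t : B)) ∈ openCode B ↔ (z, t) ∈ O := by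
  -- The digit at `(m, s)` is 1 when every point of `Z` agreeing with `z` in its first `m` entries
  -- has all of `s ∩ T` in its section of `O`. It depends only on those `m` entries, which gives
  -- continuity. Digits whose second index encodes no basic set are 1, which `openCode` ignores.
  refine ⟨fun z k => if ∀ s : TopologicalSpace.countableBasis B,
    Encodable.encode s = k.unpair.2 → ∀ z' : Z, (∀ i < k.unpair.1, z'.1 i = z.1 i) →
      ∀ t : T, t.1 ∈ s.1 → (z', t) ∈ O then 1 else 0, ?_, ?_⟩
  · refine continuous_pi fun k => IsLocallyConstant.continuous ?_
    rw [IsLocallyConstant.iff_exists_open]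
    intro z
    refine ⟨(↑) ⁻¹' PiNat.cylinder z.1 k.unpair.1, (PiNat.isOpen_cylinder _ _ _).preimage
      continuous_subtype_val, PiNat.self_mem_cylinder _ _, fun z' hz' => ?_⟩
    have hz' : ∀ i < k.unpair.1, z'.1 i = z.1 i := PiNat.mem_cylinder_iff.1 hz'
    have : ∀ y : Z, (∀ i < k.unpair.1, y.1 i = z'.1 i) ↔ (∀ i < k.unpair.1, y.1 i = z.1 i) :=
      fun y => forall₂_congr fun i hi => by rw [hz' i hi]
    simp only [this]
  · intro z t
    constructor
    · rintro ⟨m, s, h, hs⟩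
      simp only [Nat.unpair_pair, ne_eq, ite_eq_right_iff, one_ne_zero, imp_false, not_not] at h
      exact h s rfl z (fun _ _ => rfl) t hs
    · intro h
      obtain ⟨U, hU, V, hV, hUV⟩ := mem_nhds_prod_iff.1 (hO.mem_nhds h)
      obtain ⟨U', hU', hU'U⟩ := mem_nhds_subtype _ _ _ |>.1 hU
      obtain ⟨V', hV', hV'V⟩ := mem_nhds_subtype _ _ _ |>.1 hV
      obtain ⟨C, ⟨x, m, rfl⟩, hzC, hCU⟩ :=
        (PiNat.isTopologicalBasis_cylinders (E := fun _ => ℕ)).mem_nhds_iff.1 hU'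
      obtain ⟨s, hs, hts, hsV⟩ :=
        (TopologicalSpace.isBasis_countableBasis B).mem_nhds_iff.1 hV'
      refine ⟨m, ⟨s, hs⟩, ?_, hts⟩
      simp only [Nat.unpair_pair, ne_eq, ite_eq_right_iff, one_ne_zero, imp_false, not_not]
      intro s' hs' z' hz' t' ht'
      obtain rfl := Encodable.encode_injective hs'
      refine hUV ⟨hU'U (hCU ?_), hV'V (hsV ht')⟩
      rw [← PiNat.mem_cylinder_iff_eq.1 hzC]
      exact PiNat.mem_cylinder_iff.2 hz'

lemma exists_code_eq {T : Set B} {O : Set T} (hO : IsOpen O) :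
    ∃ c : Baire, ∀ t : T, (c, (t : B)) ∈ openCode B ↔ t ∈ O := by
  obtain ⟨c, -, hc⟩ := exists_openCode (Z := univ) (hO.preimage continuous_snd)
  exact ⟨c ⟨0, trivial⟩, fun t => hc _ t⟩

end OpenCode

/-- A convergent sequence together with its limit is compact, so quantifying an open condition over
it stays open: a neighbourhood of the limit handles almost all terms at once, and finitely many
remain. -/
lemma isOpen_tail {A P : Type*} [TopologicalSpace A] [TopologicalSpace P] {W : Set (A × P)}
    (hW : IsOpen W) {a : ℕ → A} {a' : A} (h : Tendsto a atTop (𝓝 a')) (N : ℕ) :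
    IsOpen {p | (a', p) ∈ W ∧ ∀ n ≥ N, (a n, p) ∈ W} := by
  rw [isOpen_iff_mem_nhds]
  rintro p ⟨hp, hpn⟩
  obtain ⟨U, hU, V, hV, hUV⟩ := mem_nhds_prod_iff.1 (hW.mem_nhds hp)
  obtain ⟨M, hM⟩ := eventually_atTop.1 (h.eventually hU)
  have hfin : ∀ᶠ p' in 𝓝 p, ∀ n ∈ Iio M, N ≤ n → (a n, p') ∈ W := by
    refine (eventually_all_finite (finite_Iio M)).2 fun n _ => eventually_imp_distrib_left.2 ?_
    intro hn
    exact (hW.preimage (Continuous.prodMk_right (a n))).mem_nhds (hpn n hn)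
  filter_upwards [hV, hfin] with p' hp' hp''
  refine ⟨hUV ⟨mem_of_mem_nhds hU, hp'⟩, fun n hn => ?_⟩
  rcases lt_or_ge n M with h1 | h1
  · exact hp'' n h1 hn
  · exact hUV ⟨hM n h1, hp'⟩

lemma isOpen_of_tendsto {X : Type*} [TopologicalSpace X] [SequentialSpace X] {U : Set X}
    (h : ∀ (x : ℕ → X) (a : X), Tendsto x atTop (𝓝 a) → a ∈ U → ∀ᶠ n in atTop, x n ∈ U) :
    IsOpen U := by
  rw [← isClosed_compl_iff]
  refine IsSeqClosed.isClosed fun x a hx ha haU => ?_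
  obtain ⟨n, hn⟩ := (h x a ha haU).exists
  exact hx n hn

/-! ### Coding of sequences in the Baire space -/

/-- The `n`-th section of a point of the Baire space. -/
def sect (n : ℕ) (p : Baire) : Baire := fun k => p (Nat.pair n k)

/-- The point of the Baire space with given sections. -/
def merge (q : ℕ → Baire) : Baire := fun k => q k.unpair.1 k.unpair.2

@[simp] lemma sect_merge (q : ℕ → Baire) (n : ℕ) : sect n (merge q) = q n := by
  ext k; simp [sect, merge]

@[fun_prop] lemma continuous_sect (n : ℕ) : Continuous (sect n) :=
  continuous_pi fun _ => continuous_apply _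

@[fun_prop] lemma continuous_merge : Continuous merge :=
  continuous_pi fun _ => (continuous_apply _).comp (continuous_apply (A := fun _ => Baire) _)

lemma exists_isEmbedding_prod : ∃ e : Baire × Baire → Baire, IsEmbedding e := by
  refine ⟨fun z => merge fun n => if n = 0 then z.1 else z.2,
    Function.LeftInverse.isEmbedding (f := fun p => (sect 0 p, sect 1 p)) ?_ ?_ ?_⟩
  · rintro ⟨a, b⟩; simp
  · fun_prop
  · refine continuous_merge.comp (continuous_pi fun n => ?_)
    split_ifs <;> fun_prop

/-- Prefix a number to a point of the Baire space. -/
def cons (n : ℕ) (p : Baire) : Baire := fun k => Nat.rec n (fun i _ => p i) k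

/-- Remove the first entry. -/
def tail (p : Baire) : Baire := fun k => p (k + 1)

lemma cons_tail (p : Baire) : cons (p 0) (tail p) = p := by
  ext k; cases k <;> rfl

@[fun_prop] lemma continuous_tail : Continuous tail := continuous_pi fun _ => continuous_apply _

@[fun_prop] lemma continuous_cons (n : ℕ) : Continuous (cons n) :=
  continuous_pi fun k => by
    cases k
    · exact continuous_const
    · exact continuous_apply _

/-! ### Sequential spaces are determined by maps from the Baire space -/

-- The map `s` sends `p` to `x n` if the first nonzero entry of `p` has index `n`, and sends the
-- zero sequence to the limit. The points `z n` consist of `n` zeros followed by ones.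
open Classical in
lemma exists_probe {X : Type*} [TopologicalSpace X] {x : ℕ → X} {a : X}
    (hx : Tendsto x atTop (𝓝 a)) :
    ∃ (s : Baire → X) (z : ℕ → Baire), Continuous s ∧ Tendsto z atTop (𝓝 0) ∧
      (∀ n, s (z n) = x n) ∧ s 0 = a := by
  let s : Baire → X := fun p => if h : ∃ k, p k ≠ 0 then x (Nat.find h) else a
  have key : ∀ (p : Baire) (n : ℕ), p n ≠ 0 → (∀ k < n, p k = 0) → s p = x n := by
    intro p n hn hk
    have h : ∃ k, p k ≠ 0 := ⟨n, hn⟩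
    have : Nat.find h = n := (Nat.find_eq_iff h).2 ⟨hn, fun k hk' => by simpa using hk k hk'⟩
    simp only [s, dif_pos h, this]
  have s0 : s 0 = a := by simp [s]
  refine ⟨s, fun n k => if k < n then 0 else 1, ?_, ?_, fun n => ?_, s0⟩
  · rw [continuous_iff_continuousAt]
    intro p
    by_cases h : ∃ k, p k ≠ 0
    · have hp := Nat.find_spec h
      have hm : ∀ k < Nat.find h, p k = 0 := fun k hk => by simpa using Nat.find_min h hk
      refine (continuousAt_const (y := s p)).congr ?_
      filter_upwards [(PiNat.isOpen_cylinder (fun _ => ℕ) p (Nat.find h + 1)).mem_nhds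
        (PiNat.self_mem_cylinder _ _)] with q hq
      rw [PiNat.mem_cylinder_iff] at hq
      rw [key p _ hp hm, key q (Nat.find h)]
      · rwa [hq _ (Nat.lt_succ_self _)]
      · intro k hk
        rw [hq k (hk.trans (Nat.lt_succ_self _)), hm k hk]
    · have hp : p = 0 := by ext k; simpa using not_exists.1 h k
      subst hp
      rw [ContinuousAt, s0]
      intro U hU
      rw [mem_map]
      obtain ⟨N, hN⟩ := eventually_atTop.1 (hx.eventually hU)
      filter_upwards [(PiNat.isOpen_cylinder (fun _ => ℕ) 0 N).mem_nhds
        (PiNat.self_mem_cylinder _ _)] with q hq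
      rw [PiNat.mem_cylinder_iff] at hq
      by_cases hq' : ∃ k, q k ≠ 0
      · simp only [s, dif_pos hq', mem_preimage]
        refine hN _ (not_lt.1 fun hlt => Nat.find_spec hq' (hq _ hlt))
      · simp only [s, dif_neg hq', mem_preimage]
        exact mem_of_mem_nhds hU
  · rw [tendsto_pi_nhds]
    intro k
    refine tendsto_const_nhds.congr' ?_
    filter_upwards [eventually_gt_atTop k] with n hn
    simp [hn]
  · exact key _ n (by simp) (fun k hk => by simp [hk])

lemma continuous_of_probe {X Y : Type*} [TopologicalSpace X] [TopologicalSpace Y]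
    [SequentialSpace X] {f : X → Y}
    (h : ∀ s : Baire → X, Continuous s → Continuous (fun p => f (s p))) : Continuous f := by
  refine SeqContinuous.continuous fun x a hx => ?_
  obtain ⟨s, z, hs, hz, hsz, rfl⟩ := exists_probe hx
  exact (((h s hs).tendsto 0).comp hz).congr fun n => by simp [hsz]

lemma isOpen_of_probe {X : Type*} [TopologicalSpace X] [SequentialSpace X] {U : Set X}
    (h : ∀ s : Baire → X, Continuous s → IsOpen (s ⁻¹' U)) : IsOpen U :=
  continuous_Prop.1 (continuous_of_probe (f := (· ∈ U)) fun s hs => continuous_Prop.2 (h s hs))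

/-! ### Admissible representations -/

namespace IsAdmissible

variable {X : Type u} [TopologicalSpace X] {D : Set Baire} {δ : D → X}

lemma lift (h : IsAdmissible δ) {W : Type*} [TopologicalSpace W] {e : W → Baire}
    (he : IsEmbedding e) {ν : W → X} (hν : Continuous ν) :
    ∃ g : W → D, Continuous g ∧ ∀ w, ν w = δ (g w) := by
  obtain ⟨g, hg, hgν⟩ := h.factors (range e) (ν ∘ he.toHomeomorph.symm)
    (hν.comp he.toHomeomorph.symm.continuous)
  exact ⟨g ∘ he.toHomeomorph, hg.comp he.toHomeomorph.continuous, fun w => by simp [← hgν]⟩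

/-- A set with open preimage under `δ` has open preimage under every map from the Baire space,
because such maps lift through `δ`; in a sequential space this makes it open. -/
lemma isQuotientMap (h : IsAdmissible δ) [SequentialSpace X] : IsQuotientMap δ := by
  refine (isQuotientMap_iff _).2 ⟨isCoinducing_iff.2 fun U =>
    ⟨fun hU => isOpen_of_probe fun s hs => ?_, fun hU => hU.preimage h.continuous⟩, h.surjective⟩
  obtain ⟨g, hg, hgs⟩ := h.lift IsEmbedding.id hs
  have : s ⁻¹' U = g ⁻¹' (δ ⁻¹' U) := by ext; simp [hgs]
  rw [this]
  exact hU.preimage hg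

end IsAdmissible

lemma mem_EQ {X : Type*} {D : Set Baire} {δ : D → X} (p q : D) :
    ((p : Baire), (q : Baire)) ∈ EQ δ ↔ δ p = δ q := by
  simp [EQ]

lemma hyp_domain {X : Type*} {D : Set Baire} {δ : D → X} (h : Hyp (EQ δ)) : Hyp D := by
  have := h.preimage (f := fun p : Baire => (p, p)) (by fun_prop)
  convert this using 1
  ext p; simp [EQ]

/-- The condition that `g d` has `n`-th entry `k` is open relative to `D`, so it is the trace of an
open set `U n k` of the whole Baire space. -/
lemma hyp_graph {D : Set Baire} (hD : Hyp D) {g : D → Baire} (hg : Continuous g) :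
    Hyp {z : Baire × Baire | ∃ h : z.1 ∈ D, g ⟨z.1, h⟩ = z.2} := by
  have h1 : ∀ n k, ∃ U : Set Baire, IsOpen U ∧ (↑) ⁻¹' U = {d : D | g d n = k} := fun n k =>
    isOpen_induced_iff.1 ((isOpen_discrete {k}).preimage ((continuous_apply n).comp hg))
  choose U hU hUg using h1
  have h2 : Hyp {z : Baire × Baire | z.1 ∈ D ∧ ∀ n k, z.2 n = k → z.1 ∈ U n k} := by
    refine (hD.preimage continuous_fst).and (Hyp.forallCountable fun n =>
      Hyp.forallCountable fun k => Hyp.imp (IsOpen.hyp ?_) (IsOpen.hyp ?_))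
    · exact (isOpen_discrete ({k} : Set ℕ)).preimage
        (f := fun z : Baire × Baire => z.2 n) (by fun_prop)
    · exact (hU n k).preimage continuous_fst
  convert h2 using 1
  ext ⟨d, y⟩
  simp only [mem_ofPred_eq, forall_eq']
  refine ⟨fun ⟨h, e⟩ => ⟨h, fun n => ?_⟩, fun ⟨h, e⟩ => ⟨h, ?_⟩⟩
  · have : (⟨d, h⟩ : D) ∈ (↑) ⁻¹' U n (y n) := by rw [hUg]; simp [e]
    exact this
  · ext n
    have : (⟨d, h⟩ : D) ∈ (↑) ⁻¹' U n (y n) := e n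
    rwa [hUg] at this

/-- The relation on names induced by a continuous map. -/
def nameRel {X Y : Type*} {D E : Set Baire} (δ : D → X) (ε : E → Y) (f : X → Y) :
    Set (Baire × Baire) :=
  {z | ∃ (hp : z.1 ∈ D) (hq : z.2 ∈ E), f (δ ⟨z.1, hp⟩) = ε ⟨z.2, hq⟩}

lemma mem_nameRel {X Y : Type*} {D E : Set Baire} {δ : D → X} {ε : E → Y} {f : X → Y}
    (p : D) (q : E) : ((p : Baire), (q : Baire)) ∈ nameRel δ ε f ↔ f (δ p) = ε q := by
  simp [nameRel]

lemma hyp_nameRel {X Y : Type*} [TopologicalSpace X] [TopologicalSpace Y] {D E : Set Baire}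
    {δ : D → X} {ε : E → Y} (hδ : IsAdmissible δ) (hε : IsAdmissible ε) (hδ' : Hyp (EQ δ))
    (hε' : Hyp (EQ ε)) {f : X → Y} (hf : Continuous f) : Hyp (nameRel δ ε f) := by
  -- A realizer `g` of `f` reduces the relation to: some `y` is the value of `g` and names the same
  -- point as the second component.
  obtain ⟨g, hg, hfg⟩ := hε.factors D (f ∘ δ) (hf.comp hδ.continuous)
  have h1 := hyp_graph (hyp_domain hδ') (continuous_subtype_val.comp hg)
  have h2 : Hyp {z : Baire × Baire | ∃ y : Baire,
      (∃ h : z.1 ∈ D, (g ⟨z.1, h⟩ : Baire) = y) ∧ (y, z.2) ∈ EQ ε} := by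
    refine Hyp.existsBaire (Hyp.and ?_ ?_)
    · exact h1.preimage (f := fun z : Baire × Baire × Baire => (z.2.1, z.1)) (by fun_prop)
    · exact hε'.preimage (f := fun z : Baire × Baire × Baire => (z.1, z.2.2)) (by fun_prop)
  convert h2 using 1
  ext ⟨d, e⟩
  constructor
  · rintro ⟨hd, he, h⟩
    exact ⟨_, ⟨hd, rfl⟩, (mem_EQ (g ⟨d, hd⟩) ⟨e, he⟩).2 (by rw [← hfg]; exact h)⟩
  · rintro ⟨_, ⟨hd, rfl⟩, _, he, h⟩
    exact ⟨hd, he, by rw [← h]; exact hfg ⟨d, hd⟩⟩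

/-! ### Basic facts on qcb₀-spaces -/

lemma isQCB0_of_isQuotientMap {X : Type u} [TopologicalSpace X] [T0Space X] {D : Type}
    [TopologicalSpace D] [SecondCountableTopology D] {q : D → X}
    (hq : IsQuotientMap q) : IsQCB0 (TopCat.of X) :=
  ⟨‹_›, TopCat.of (ULift.{u} D), q ∘ ULift.down, Homeomorph.ulift.secondCountableTopology,
    hq.comp Homeomorph.ulift.isQuotientMap⟩

lemma isQCB0_of_secondCountable (X : Type u) [TopologicalSpace X] [T0Space X]
    [SecondCountableTopology X] : IsQCB0 (TopCat.of X) :=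
  ⟨‹_›, TopCat.of X, id, ‹_›, IsQuotientMap.id⟩

instance (X : QCB0.{u}) : T0Space X.obj := X.property.1

instance (X : QCB0.{u}) : SequentialSpace X.obj := by
  obtain ⟨-, Z, q, hZ, hq⟩ := X.property
  exact hq.sequentialSpace

lemma HP_iff {X : QCB0.{u}} :
    HP X ↔ ∃ (D : Set Baire) (δ : D → X.obj), IsAdmissible δ ∧ Hyp (EQ δ) := by
  constructor
  · rintro ⟨α, hα, D, δ, h, h'⟩
    exact ⟨D, δ, h, α, hα, h'⟩
  · rintro ⟨D, δ, h, α, hα, h'⟩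
    exact ⟨α, hα, D, δ, h, h'⟩

/-! ### Admissible representations of quotients -/

/-- Let `q` exhibit the `T₀`-space `X` as the `T₀`-quotient of a hyperprojective subspace `D` of the
Baire space by a hyperprojective relation `R`. Then `X` has a hyperprojective admissible
representation: a name of `x` codes the open set of all codes of open neighbourhoods of `x`. -/
theorem exists_isAdmissible_of_quotient {X : Type u} [TopologicalSpace X] [T0Space X]
    {D : Set Baire} (hD : Hyp D) {q : D → X} (hq : Continuous q) (hs : Function.Surjective q)
    {R : Set (Baire × Baire)} (hR : Hyp R)
    (hcompat : ∀ d e : D, ((d : Baire), (e : Baire)) ∈ R → q d = q e)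
    (hopen : ∀ V : Set D, IsOpen V →
      (∀ d e : D, ((d : Baire), (e : Baire)) ∈ R → (d ∈ V ↔ e ∈ V)) →
      ∃ U, IsOpen U ∧ V = q ⁻¹' U) :
    ∃ (D' : Set Baire) (δ : D' → X), IsAdmissible δ ∧ Hyp (EQ δ) := by
  let W := openCode Baire
  have hW : IsOpen W := isOpen_openCode
  -- Codes of `R`-invariant open subsets of `D`; by `hopen` and `hcompat` these are exactly the
  -- codes of open subsets of `X`.
  let T : Set Baire := {r | ∀ d e : Baire, d ∈ D → e ∈ D → (d, e) ∈ R → ((r, d) ∈ W ↔ (r, e) ∈ W)}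
  have hT : Hyp T := by
    refine Hyp.forallBaire (Hyp.forallBaire (Hyp.imp ?_ (Hyp.imp ?_ (Hyp.imp ?_ (Hyp.iff ?_ ?_)))))
    · exact hD.preimage (f := fun z : Baire × Baire × Baire => z.2.1) (by fun_prop)
    · exact hD.preimage (f := fun z : Baire × Baire × Baire => z.1) (by fun_prop)
    · exact hR.preimage (f := fun z : Baire × Baire × Baire => (z.2.1, z.1)) (by fun_prop)
    · exact hW.hyp.preimage (f := fun z : Baire × Baire × Baire => (z.2.2, z.2.1)) (by fun_prop)
    · exact hW.hyp.preimage (f := fun z : Baire × Baire × Baire => (z.2.2, z.1)) (by fun_prop)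
  have hO : ∀ r : T, ∃ U : Set X, IsOpen U ∧
      ∀ d : D, q d ∈ U ↔ ((r : Baire), (d : Baire)) ∈ W := by
    intro r
    obtain ⟨U, hU, h⟩ := hopen {d | ((r : Baire), (d : Baire)) ∈ W}
      (hW.preimage (f := fun d : D => ((r : Baire), (d : Baire))) (by fun_prop))
      (fun d e h => r.2 d e d.2 e.2 h)
    exact ⟨U, hU, fun d => (Set.ext_iff.1 h d).symm⟩
  choose O hO hOW using hO
  have hO' : ∀ U : Set X, IsOpen U → ∃ r : T, O r = U := by
    intro U hU
    obtain ⟨r, hr⟩ := exists_code_eq (hU.preimage hq)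
    have hrT : r ∈ T := by
      intro d e hd he hde
      have h1 := hr ⟨d, hd⟩
      have h2 := hr ⟨e, he⟩
      rw [mem_preimage, hcompat ⟨d, hd⟩ ⟨e, he⟩ hde] at h1
      exact h1.trans h2.symm
    refine ⟨⟨r, hrT⟩, ?_⟩
    ext x
    obtain ⟨d, rfl⟩ := hs x
    exact (hOW _ d).trans (hr d)
  -- Among elements of `T`, the open set coded by `p` consists of the codes of open neighbourhoods
  -- of `q d`; by `T₀` this determines `q d`.
  let P : Baire → Baire → Prop := fun p d => ∀ r, r ∈ T → ((p, r) ∈ W ↔ (r, d) ∈ W)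
  have hP : Hyp {z : Baire × Baire | P z.1 z.2} := by
    refine Hyp.forallBaire (Hyp.imp ?_ (Hyp.iff ?_ ?_))
    · exact hT.preimage (f := fun z : Baire × Baire × Baire => z.1) (by fun_prop)
    · exact hW.hyp.preimage (f := fun z : Baire × Baire × Baire => (z.2.1, z.1)) (by fun_prop)
    · exact hW.hyp.preimage (f := fun z : Baire × Baire × Baire => (z.1, z.2.2)) (by fun_prop)
  let D' : Set Baire := {p | ∃ d : D, P p d}
  let δ : D' → X := fun p => q p.2.choose
  have hδ : ∀ (p : D') (r : T), δ p ∈ O r ↔ ((p : Baire), (r : Baire)) ∈ W := fun p r =>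
    (hOW r _).trans (p.2.choose_spec r r.2).symm
  have hsep : ∀ x y : X, (∀ r, x ∈ O r ↔ y ∈ O r) → x = y := by
    intro x y h
    refine (inseparable_iff_forall_isOpen.2 fun U hU => ?_).eq
    obtain ⟨r, rfl⟩ := hO' U hU
    exact h r
  have hδq : ∀ (p : D') (d : D), P p d → δ p = q d := fun p d h =>
    hsep _ _ fun r => by rw [hδ, hOW]; exact h r r.2
  have hfac : ∀ (Z : Set Baire) (ν : Z → X), Continuous ν →
      ∃ g : Z → D', Continuous g ∧ ∀ z, ν z = δ (g z) := by
    intro Z ν hν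
    -- The heart of admissibility: membership is jointly open in point and code. If codes converge,
    -- those points lying in the limit open set and in all late ones form an open set by
    -- `isOpen_tail`, computed on `D` and descended by `hopen`; the points `ν` then eventually enter
    -- it.
    have hopen' : IsOpen {z : Z × T | ν z.1 ∈ O z.2} := by
      refine isOpen_of_tendsto fun w a hw (ha : ν a.1 ∈ O a.2) => ?_
      have hw1 : Tendsto (fun n => (w n).1) atTop (𝓝 a.1) := (continuous_fst.tendsto a).comp hw
      have hw2 : Tendsto (fun n => (w n).2) atTop (𝓝 a.2) := (continuous_snd.tendsto a).comp hw
      have hev : ∀ᶠ n in atTop, ν a.1 ∈ O (w n).2 := by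
        obtain ⟨d, hd⟩ := hs (ν a.1)
        rw [← hd, hOW] at ha
        simp only [← hd, hOW]
        have : Tendsto (fun n => (((w n).2 : Baire), (d : Baire))) atTop
            (𝓝 ((a.2 : Baire), (d : Baire))) :=
          ((continuous_subtype_val.tendsto _).comp hw2).prodMk_nhds tendsto_const_nhds
        exact this.eventually (hW.mem_nhds ha)
      obtain ⟨N, hN⟩ := eventually_atTop.1 hev
      have hV : IsOpen {x | x ∈ O a.2 ∧ ∀ n ≥ N, x ∈ O (w n).2} := by
        have h1 := isOpen_tail (hW.preimage
          (f := fun z : T × D => ((z.1 : Baire), (z.2 : Baire))) (by fun_prop)) hw2 N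
        obtain ⟨U, hU, h⟩ := hopen _ h1 (fun d e hde => by
          simp only [mem_ofPred_eq, mem_preimage, ← hOW, hcompat d e hde])
        convert hU using 1
        ext x
        obtain ⟨d, rfl⟩ := hs x
        rw [show (q d ∈ U) = (d ∈ q ⁻¹' U) from rfl, ← h]
        simp only [mem_ofPred_eq, mem_preimage, ← hOW]
      have h2 := ((hν.tendsto _).comp hw1).eventually (hV.mem_nhds ⟨ha, hN⟩)
      filter_upwards [h2, eventually_ge_atTop N] with n hn hnN using hn.2 n hnN
    obtain ⟨c, hc, hcW⟩ := exists_openCode hopen'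
    have hcP : ∀ z (d : D), q d = ν z → P (c z) d := by
      intro z d hd r hr
      rw [← hOW ⟨r, hr⟩, hd]
      exact hcW z ⟨r, hr⟩
    refine ⟨fun z => ⟨c z, (hs (ν z)).choose, hcP z _ (hs (ν z)).choose_spec⟩, by fun_prop,
      fun z => ?_⟩
    obtain ⟨d, hd⟩ := hs (ν z)
    rw [hδq _ d (hcP z d hd), hd]
  refine ⟨D', δ, ⟨fun x => ?_, ?_, hfac⟩, ?_⟩
  · obtain ⟨g, -, hg⟩ := hfac univ (fun _ => x) continuous_const
    exact ⟨g ⟨0, trivial⟩, (hg _).symm⟩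
  · refine continuous_def.2 fun U hU => ?_
    obtain ⟨r, rfl⟩ := hO' U hU
    have : δ ⁻¹' O r = (fun p : D' => ((p : Baire), (r : Baire))) ⁻¹' W := by
      ext p; exact hδ p r
    rw [this]
    exact hW.preimage (by fun_prop)
  -- Two names denote the same point exactly when a single `d` witnesses both.
  · have h1 : Hyp {z : Baire × Baire | ∃ d : Baire, d ∈ D ∧ P z.1 d ∧ P z.2 d} := by
      refine Hyp.existsBaire (Hyp.and ?_ (Hyp.and ?_ ?_))
      · exact hD.preimage (f := fun z : Baire × Baire × Baire => z.1) (by fun_prop)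
      · exact hP.preimage (f := fun z : Baire × Baire × Baire => (z.2.1, z.1)) (by fun_prop)
      · exact hP.preimage (f := fun z : Baire × Baire × Baire => (z.2.2, z.1)) (by fun_prop)
    convert h1 using 1
    ext ⟨p, p'⟩
    constructor
    · rintro ⟨hp, hp', h⟩
      obtain ⟨d, hd⟩ := id hp'
      refine ⟨d, d.2, fun r hr => ?_, hd⟩
      rw [← hOW ⟨r, hr⟩, ← hδq ⟨p', hp'⟩ d hd, ← h]
      exact (hδ ⟨p, hp⟩ ⟨r, hr⟩).symm
    · rintro ⟨d, hd, h, h'⟩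
      exact ⟨⟨⟨d, hd⟩, h⟩, ⟨⟨d, hd⟩, h'⟩,
        (hδq ⟨p, _⟩ ⟨d, hd⟩ h).trans (hδq ⟨p', _⟩ ⟨d, hd⟩ h').symm⟩

/-! ### Admissible representations of spaces of continuous functions -/

/-- A copy of `C(X, Y)` without topology. -/
structure MapSpace (X Y : Type*) [TopologicalSpace X] [TopologicalSpace Y] where
  /-- The underlying continuous map. -/
  toMap : C(X, Y)

lemma continuous_evalNat : Continuous fun z : Baire × ℕ => z.1 z.2 :=
  continuous_prod_of_discrete_right.2 fun n => continuous_apply n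

/-- The exponential of two sequential spaces with hyperprojective admissible representations has
such a representation. A name of `f` codes the open set of those `(x, n, k)` for which the value
at `x` of a function realizing `f` has `n`-th entry `k`. -/
theorem exists_exponential {X Y : Type u} [TopologicalSpace X] [TopologicalSpace Y]
    [SequentialSpace X] [T0Space Y] {A B : Set Baire} {δ : A → X} {ε : B → Y}
    (hδ : IsAdmissible δ) (hε : IsAdmissible ε) (hδ' : Hyp (EQ δ)) (hε' : Hyp (EQ ε)) :
    ∃ (E : Type u) (_ : TopologicalSpace E) (app : E → C(X, Y)), Function.Bijective app ∧
      T0Space E ∧ (∃ (D : Set Baire) (γ : D → E), IsAdmissible γ ∧ Hyp (EQ γ) ∧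
        IsQuotientMap γ) ∧
      ∀ s : Baire → E, Continuous s ↔ Continuous fun z : Baire × A => app (s z.1) (δ z.2) := by
  let W := openCode (Baire × ℕ × ℕ)
  have hW : IsOpen W := isOpen_openCode
  let G : Baire → Baire → Baire → Prop := fun p x y => ∀ n k, (p, x, n, k) ∈ W ↔ y n = k
  have hG : Hyp {z : Baire × Baire × Baire | G z.1 z.2.1 z.2.2} := by
    refine Hyp.forallCountable fun n => Hyp.forallCountable fun k => Hyp.iff ?_ (IsOpen.hyp ?_)
    · exact hW.hyp.preimage (f := fun z : Baire × Baire × Baire => (z.1, z.2.1, n, k))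
        (by fun_prop)
    · exact (isOpen_discrete ({k} : Set ℕ)).preimage
        (f := fun z : Baire × Baire × Baire => z.2.2 n) (by fun_prop)
  have hGu : ∀ {p x y y'}, G p x y → G p x y' → y = y' := by
    intro p x y y' h h'
    ext n
    exact (h n _).1 ((h' n _).2 rfl)
  have hA := hyp_domain hδ'
  -- The second clause with `x = x'` also forces the values into `B`, because `EQ ε` relates only
  -- elements of `B`.
  let D : Set Baire := {p | (∀ x, x ∈ A → ∃ y, G p x y) ∧
    ∀ x x' y y', (x, x') ∈ EQ δ → G p x y → G p x' y' → (y, y') ∈ EQ ε}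
  have hD : Hyp D := by
    refine Hyp.and (Hyp.forallBaire (Hyp.imp ?_ (Hyp.existsBaire ?_))) (Hyp.forallBaire
      (Hyp.forallBaire (Hyp.forallBaire (Hyp.forallBaire (Hyp.imp ?_ (Hyp.imp ?_
        (Hyp.imp ?_ ?_)))))))
    · exact hA.preimage (f := fun z : Baire × Baire => z.1) (by fun_prop)
    · exact hG.preimage (f := fun z : Baire × Baire × Baire => (z.2.2, z.2.1, z.1)) (by fun_prop)
    · exact hδ'.preimage (f := fun z : Baire × Baire × Baire × Baire × Baire =>
        (z.2.2.2.1, z.2.2.1)) (by fun_prop)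
    · exact hG.preimage (f := fun z : Baire × Baire × Baire × Baire × Baire =>
        (z.2.2.2.2, z.2.2.2.1, z.2.1)) (by fun_prop)
    · exact hG.preimage (f := fun z : Baire × Baire × Baire × Baire × Baire =>
        (z.2.2.2.2, z.2.2.1, z.1)) (by fun_prop)
    · exact hε'.preimage (f := fun z : Baire × Baire × Baire × Baire × Baire =>
        (z.2.1, z.1)) (by fun_prop)
  have hF : ∀ (p : D) (x : A), ∃ y : B, G p x y := by
    intro p x
    obtain ⟨y, hy⟩ := p.2.1 x x.2
    obtain ⟨hyB, -, -⟩ := p.2.2 x x y y ((mem_EQ x x).2 rfl) hy hy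
    exact ⟨⟨y, hyB⟩, hy⟩
  choose F hF using hF
  have hFc : Continuous fun z : D × A => F z.1 z.2 := by
    refine Continuous.subtype_mk (continuous_pi fun n => continuous_discrete_rng.2 fun k => ?_) _
    have : (fun z : D × A => (F z.1 z.2 : Baire) n) ⁻¹' {k} =
        (fun z : D × A => ((z.1 : Baire), (z.2 : Baire), n, k)) ⁻¹' W := by
      ext z
      exact (hF z.1 z.2 n k).symm
    rw [this]
    exact hW.preimage (by fun_prop)
  have hlift : ∀ p : D, ∃ f : C(X, Y), ∀ x, f (δ x) = ε (F p x) := by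
    intro p
    have h : ∀ x, ε (F p (Function.surjInv hδ.surjective (δ x))) = ε (F p x) := fun x =>
      (mem_EQ _ _).1 (p.2.2 _ x _ _ ((mem_EQ _ x).2 (Function.surjInv_eq _ _)) (hF p _) (hF p x))
    refine ⟨⟨fun x => ε (F p (Function.surjInv hδ.surjective x)), ?_⟩, h⟩
    rw [hδ.isQuotientMap.continuous_iff]
    exact (hε.continuous.comp (hFc.comp (Continuous.prodMk_right p))).congr fun x => (h x).symm
  choose γ hγ using hlift
  have hγext : ∀ {f g : C(X, Y)}, (∀ x, f (δ x) = g (δ x)) → f = g := by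
    intro f g h
    ext x
    obtain ⟨a, rfl⟩ := hδ.surjective x
    exact h a
  -- A jointly continuous family of maps has continuously chosen names: lift its uncurried form
  -- through `ε`, then code the open graph of the lift.
  have key : ∀ (Z : Set Baire) (ν : Z → C(X, Y)), Continuous (fun z : Z × A => ν z.1 (δ z.2)) →
      ∃ g : Z → D, Continuous g ∧ ∀ z, ν z = γ (g z) := by
    intro Z ν hν
    obtain ⟨e, he⟩ := exists_isEmbedding_prod
    have hZA : IsEmbedding (Prod.map Subtype.val Subtype.val : Z × A → Baire × Baire) :=
      IsEmbedding.subtypeVal.prodMap IsEmbedding.subtypeVal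
    obtain ⟨h, hh, hhν⟩ := hε.lift (he.comp hZA) hν
    let T : Set (Baire × ℕ × ℕ) := {t | t.1 ∈ A}
    have hO : IsOpen {z : Z × T | (h (z.1, ⟨z.2.1.1, z.2.2⟩) : Baire) z.2.1.2.1 = z.2.1.2.2} := by
      have h1 : Continuous fun z : Z × T => (h (z.1, ⟨z.2.1.1, z.2.2⟩) : Baire) z.2.1.2.1 :=
        continuous_evalNat.comp (f := fun z : Z × T =>
          ((h (z.1, ⟨z.2.1.1, z.2.2⟩) : Baire), z.2.1.2.1)) (by fun_prop)
      exact (isOpen_discrete {z : ℕ × ℕ | z.1 = z.2}).preimage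
        (h1.prodMk (g := fun z : Z × T => z.2.1.2.2) (by fun_prop))
    obtain ⟨c, hc, hcW⟩ := exists_openCode hO
    have hcG : ∀ (z : Z) (x : A), G (c z) x (h (z, x)) := fun z x n k =>
      hcW z ⟨(x, n, k), x.2⟩
    have hcD : ∀ z, c z ∈ D := by
      refine fun z => ⟨fun x hx => ⟨_, hcG z ⟨x, hx⟩⟩, ?_⟩
      rintro x x' y y' ⟨hx, hx', hxx'⟩ hy hy'
      obtain rfl := hGu hy (hcG z ⟨x, hx⟩)
      obtain rfl := hGu hy' (hcG z ⟨x', hx'⟩)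
      rw [mem_EQ, ← hhν, ← hhν]
      exact congrArg (ν z) hxx'
    refine ⟨fun z => ⟨c z, hcD z⟩, by fun_prop, fun z => hγext fun x => ?_⟩
    rw [hγ, show F ⟨c z, hcD z⟩ x = h (z, x) from Subtype.ext (hGu (hF ⟨c z, hcD z⟩ x) (hcG z x))]
    exact hhν (z, x)
  let E := MapSpace X Y
  let γ' : D → E := fun p => ⟨γ p⟩
  -- The final topology makes `γ'` a quotient map. That it admits no more continuous families than
  -- the jointly continuous ones is `hjoint`.
  let _ : TopologicalSpace E := .coinduced γ' inferInstance
  have hγ'c : Continuous γ' := continuous_coinduced_rng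
  have hγ's : Function.Surjective γ' := by
    intro f
    obtain ⟨g, -, hg⟩ := key univ (fun _ => f.toMap)
      ((map_continuous f.toMap).comp (hδ.continuous.comp continuous_snd))
    exact ⟨g ⟨0, trivial⟩, congrArg MapSpace.mk (hg _).symm⟩
  have hjoint : ∀ (Z : Set Baire) (s : Z → E), Continuous s →
      Continuous (fun z : Z × A => (s z.1).toMap (δ z.2)) := by
    intro Z s hs
    refine continuous_iff_seqContinuous.2 fun w a hw => ?_
    have hw1 : Tendsto (fun n => (w n).1) atTop (𝓝 a.1) := (continuous_fst.tendsto a).comp hw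
    have hw2 : Tendsto (fun n => (w n).2) atTop (𝓝 a.2) := (continuous_snd.tendsto a).comp hw
    refine tendsto_nhds.2 fun V hV haV => ?_
    have hev : ∀ᶠ n in atTop, (s a.1).toMap (δ (w n).2) ∈ V :=
      ((((map_continuous (s a.1).toMap).comp hδ.continuous).tendsto a.2).comp hw2).eventually
        (hV.mem_nhds haV)
    obtain ⟨N, hN⟩ := eventually_atTop.1 hev
    -- Sending a convergent sequence and its limit into `V` is an open condition on `f`: this is
    -- `isOpen_tail` on names, transferred by the final topology.
    have hK : IsOpen {f : E | f.toMap (δ a.2) ∈ V ∧ ∀ n ≥ N, f.toMap (δ (w n).2) ∈ V} := by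
      refine isOpen_coinduced.2 ?_
      have h1 := isOpen_tail (hV.preimage (f := fun z : A × D => ε (F z.2 z.1))
        (hε.continuous.comp (hFc.comp (continuous_snd.prodMk continuous_fst)))) hw2 N
      convert h1 using 1
      ext p
      simp [γ', hγ]
    have h2 := ((hs.tendsto _).comp hw1).eventually (hK.mem_nhds ⟨haV, hN⟩)
    filter_upwards [h2, eventually_ge_atTop N] with n hn hnN using hn.2 n hnN
  have hfac : ∀ (Z : Set Baire) (ν : Z → E), Continuous ν →
      ∃ g : Z → D, Continuous g ∧ ∀ z, ν z = γ' (g z) := by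
    intro Z ν hν
    obtain ⟨g, hg, hg'⟩ := key Z (fun z => (ν z).toMap) (hjoint Z ν hν)
    exact ⟨g, hg, fun z => congrArg MapSpace.mk (hg' z)⟩
  refine ⟨E, ‹_›, MapSpace.toMap, ⟨fun f g h => congrArg MapSpace.mk h, fun f => ⟨⟨f⟩, rfl⟩⟩,
    ⟨fun f g hfg => congrArg MapSpace.mk (hγext fun x => ?_)⟩,
    ⟨D, γ', ⟨hγ's, hγ'c, hfac⟩, ?_, ⟨⟨rfl⟩, hγ's⟩⟩, fun s => ⟨fun hs => ?_, fun hs => ?_⟩⟩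
  · have : Continuous fun f : E => f.toMap (δ x) := by
      refine continuous_coinduced_dom.2 ?_
      have : (fun f : E => f.toMap (δ x)) ∘ γ' = fun p => ε (F p x) := by ext p; simp [γ', hγ]
      rw [this]
      exact hε.continuous.comp (hFc.comp (Continuous.prodMk_left x))
    exact (hfg.map this).eq
  · have h1 : Hyp {z : Baire × Baire | z.1 ∈ D ∧ z.2 ∈ D ∧ ∀ x y y', x ∈ A → G z.1 x y →
        G z.2 x y' → (y, y') ∈ EQ ε} := by
      refine Hyp.and (hD.preimage continuous_fst) (Hyp.and (hD.preimage continuous_snd)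
        (Hyp.forallBaire (Hyp.forallBaire (Hyp.forallBaire (Hyp.imp ?_ (Hyp.imp ?_
          (Hyp.imp ?_ ?_)))))))
      · exact hA.preimage (f := fun z : Baire × Baire × Baire × Baire × Baire => z.2.2.1)
          (by fun_prop)
      · exact hG.preimage (f := fun z : Baire × Baire × Baire × Baire × Baire =>
          (z.2.2.2.1, z.2.2.1, z.2.1)) (by fun_prop)
      · exact hG.preimage (f := fun z : Baire × Baire × Baire × Baire × Baire =>
          (z.2.2.2.2, z.2.2.1, z.1)) (by fun_prop)
      · exact hε'.preimage (f := fun z : Baire × Baire × Baire × Baire × Baire =>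
          (z.2.1, z.1)) (by fun_prop)
    convert h1 using 1
    ext ⟨p, p'⟩
    refine ⟨fun ⟨hp, hp', h⟩ => ⟨hp, hp', fun x y y' hx hy hy' => ?_⟩, fun ⟨hp, hp', h⟩ =>
      ⟨hp, hp', congrArg MapSpace.mk (hγext fun x => ?_)⟩⟩
    · obtain rfl := hGu hy (hF ⟨p, hp⟩ ⟨x, hx⟩)
      obtain rfl := hGu hy' (hF ⟨p', hp'⟩ ⟨x, hx⟩)
      rw [mem_EQ, ← hγ, ← hγ]
      exact DFunLike.congr_fun (congrArg MapSpace.toMap h) _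
    · rw [hγ, hγ]
      exact (mem_EQ _ _).1 (h x _ _ x.2 (hF ⟨p, hp⟩ x) (hF ⟨p', hp'⟩ x))
  · exact (hjoint univ (fun z => s z) (hs.comp continuous_subtype_val)).comp
      (f := fun z : Baire × A => ((⟨z.1, trivial⟩ : (univ : Set Baire)), z.2)) (by fun_prop)
  · obtain ⟨g, hg, hgs⟩ := key univ (fun z => (s z).toMap) (hs.comp
      (f := fun z : ↥(univ : Set Baire) × A => ((z.1 : Baire), z.2)) (by fun_prop))
    have : s = fun p => γ' (g ⟨p, trivial⟩) := by
      ext1 p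
      exact congrArg MapSpace.mk (hgs ⟨p, trivial⟩)
    rw [this]
    exact hγ'c.comp (hg.comp (by fun_prop))

/-! ### The category of qcb₀-spaces -/

namespace QCB0

/-- The morphism given by a continuous map. -/
abbrev mkHom {X Y : QCB0.{u}} (f : X.obj → Y.obj) (hf : Continuous f) : X ⟶ Y :=
  ObjectProperty.homMk (TopCat.ofHom ⟨f, hf⟩)

lemma hom_ext {X Y : QCB0.{u}} {f g : X ⟶ Y} (h : ∀ x, f.hom x = g.hom x) : f = g :=
  ObjectProperty.hom_ext _ (TopCat.ext h)

lemma continuous {X Y : QCB0.{u}} (f : X ⟶ Y) : Continuous f.hom := f.hom.hom.continuous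

lemma congr_hom {X Y : QCB0.{u}} {f g : X ⟶ Y} (h : f = g) (x : X.obj) : f.hom x = g.hom x := by
  rw [h]

/-- The second countable `T₀`-space `X`, as a qcb₀-space. -/
abbrev ofSecondCountable (X : Type u) [TopologicalSpace X] [T0Space X]
    [SecondCountableTopology X] : QCB0.{u} := ⟨TopCat.of X, isQCB0_of_secondCountable X⟩

/-- Points are morphisms from the one-point space, so arbitrary limit cones can be handled
pointwise. -/
lemma eq_of_isLimit {J : Type} [SmallCategory J] {F : J ⥤ QCB0.{u}} {c : Cone F} (hc : IsLimit c)
    {x y : c.pt.obj} (h : ∀ j, (c.π.app j).hom x = (c.π.app j).hom y) : x = y := by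
  let p (x : c.pt.obj) : ofSecondCountable PUnit.{u + 1} ⟶ c.pt := mkHom (fun _ => x)
    continuous_const
  have : p x = p y := hc.hom_ext fun j => hom_ext fun _ => h j
  exact congr_hom this PUnit.unit

end QCB0

open QCB0

/-! ### Limits -/

section Limits

variable {J : Type} [SmallCategory J]

/-- Compatible families of points of a diagram, without topology. -/
structure CompatibleFamily (F : J ⥤ QCB0.{u}) : Type u where
  /-- The components of the family. -/
  val : ∀ j, (F.obj j).obj
  compat : ∀ {i j : J} (f : i ⟶ j), (F.map f).hom (val i) = val j

lemma CompatibleFamily.ext {F : J ⥤ QCB0.{u}} {x y : CompatibleFamily F}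
    (h : ∀ j, x.val j = y.val j) : x = y := by
  cases x; cases y
  congr
  exact funext h

theorem exists_limit [CountableCategory J] (F : J ⥤ QCB0.{u}) (hF : ∀ j, HP (F.obj j)) :
    ∃ c : Cone F, Nonempty (IsLimit c) ∧ HP c.pt := by
  choose D δ hδ hEQ using fun j => HP_iff.1 (hF j)
  obtain ⟨e, he⟩ := exists_injective_nat J
  let R : ∀ {i j : J}, (i ⟶ j) → Set (Baire × Baire) := fun {i j} f =>
    nameRel (δ i) (δ j) (F.map f).hom
  have hR : ∀ {i j : J} (f : i ⟶ j), Hyp (R f) := fun f =>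
    hyp_nameRel (hδ _) (hδ _) (hEQ _) (hEQ _) (QCB0.continuous _)
  let DL : Set Baire := {p | (∀ j, sect (e j) p ∈ D j) ∧
    ∀ i j (f : i ⟶ j), (sect (e i) p, sect (e j) p) ∈ R f}
  have hDL : Hyp DL := by
    refine Hyp.and (Hyp.forallCountable fun j => ?_) (Hyp.forallCountable fun i =>
      Hyp.forallCountable fun j => Hyp.forallCountable fun f => ?_)
    · exact (hyp_domain (hEQ j)).preimage (continuous_sect _)
    · exact (hR f).preimage (f := fun p => (sect (e i) p, sect (e j) p)) (by fun_prop)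
  let L := CompatibleFamily F
  let δL : DL → L := fun p => ⟨fun j => δ j ⟨sect (e j) p, p.2.1 j⟩, fun {i j} f =>
    (mem_nameRel ⟨_, p.2.1 i⟩ ⟨_, p.2.1 j⟩).1 (p.2.2 i j f)⟩
  -- The subspace topology of the product need not be sequential. The final topology has the same
  -- continuous maps from subspaces of the Baire space, by `key`, and that suffices for the
  -- universal property.
  let _ : TopologicalSpace L := .coinduced δL inferInstance
  have hδLc : Continuous δL := continuous_coinduced_rng
  have hπ : ∀ j, Continuous fun x : L => x.val j := fun j => by
    refine continuous_coinduced_dom.2 ((hδ j).continuous.comp ?_)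
    exact Continuous.subtype_mk ((continuous_sect _).comp continuous_subtype_val) _
  have hT0 : T0Space L := ⟨fun x y h => CompatibleFamily.ext fun j => (h.map (hπ j)).eq⟩
  have key : ∀ {W : Type} [TopologicalSpace W] {ι : W → Baire}, IsEmbedding ι → ∀ ν : W → L,
      (∀ j, Continuous fun w => (ν w).val j) →
      ∃ g : W → DL, Continuous g ∧ ∀ w, ν w = δL (g w) := by
    intro W _ ι hι ν hν
    choose g hg hgν using fun j => (hδ j).lift hι (hν j)
    -- Sections whose index is not in the range of `e` carry no information and are set to 0.
    let G : W → Baire := fun w => merge (Function.extend e (fun j => (g j w : Baire)) 0)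
    have hG : ∀ w j, sect (e j) (G w) = g j w := fun w j => by
      simp only [G, sect_merge]
      exact he.extend_apply _ _ _
    have hGD : ∀ w, G w ∈ DL := by
      refine fun w => ⟨fun j => ?_, fun i j f => ?_⟩
      · rw [hG]; exact (g j w).2
      · rw [hG, hG, mem_nameRel, ← hgν, ← hgν]
        exact (ν w).compat f
    have hGc : Continuous G := by
      refine continuous_merge.comp (continuous_pi fun n => ?_)
      by_cases hn : ∃ j, e j = n
      · obtain ⟨j, rfl⟩ := hn
        simp only [he.extend_apply]
        exact continuous_subtype_val.comp (hg j)
      · simp only [Function.extend_apply' _ _ _ hn]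
        exact continuous_const
    refine ⟨fun w => ⟨G w, hGD w⟩, hGc.subtype_mk _, fun w => CompatibleFamily.ext fun j => ?_⟩
    rw [hgν]
    exact congrArg (δ j) (Subtype.ext (hG w j).symm)
  have hadm : IsAdmissible δL := by
    refine ⟨fun x => ?_, hδLc, fun Z ν hν => ?_⟩
    · obtain ⟨g, -, hg⟩ := key IsEmbedding.id (fun _ => x) fun _ => continuous_const
      exact ⟨g 0, (hg 0).symm⟩
    · exact key IsEmbedding.subtypeVal ν fun j => (hπ j).comp hν
  let P : QCB0.{u} := ⟨TopCat.of L, isQCB0_of_isQuotientMap (q := δL) ⟨⟨rfl⟩, hadm.surjective⟩⟩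
  let c : Cone F :=
    { pt := P
      π :=
        { app := fun j => mkHom (X := P) (fun x : L => x.val j) (hπ j)
          naturality := fun i j f => QCB0.hom_ext fun x => (CompatibleFamily.compat x f).symm } }
  have hcompat : ∀ (s : Cone F) (x : s.pt.obj) {i j : J} (f : i ⟶ j),
      (F.map f).hom ((s.π.app i).hom x) = (s.π.app j).hom x := fun s x i j f =>
    congr_hom (s.w f) x
  have hlc : ∀ s : Cone F, Continuous fun x : s.pt.obj =>
      (⟨fun j => (s.π.app j).hom x, hcompat s x⟩ : L) := by
    intro s
    refine continuous_of_probe fun t ht => ?_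
    have h1 : ∀ j, Continuous fun p => (s.π.app j).hom (t p) := fun j =>
      (QCB0.continuous (s.π.app j)).comp ht
    obtain ⟨g, hg, hgs⟩ := key IsEmbedding.id
      (fun p => (⟨fun j => (s.π.app j).hom (t p), hcompat s (t p)⟩ : L)) h1
    exact (hδLc.comp hg).congr fun p => (hgs p).symm
  refine ⟨c, ⟨?_⟩, HP_iff.2 ⟨DL, δL, hadm, ?_⟩⟩
  · exact
      { lift := fun s => mkHom (Y := P) _ (hlc s)
        fac := fun s j => QCB0.hom_ext fun x => rfl
        uniq := fun s m hm => QCB0.hom_ext fun x => CompatibleFamily.ext fun j =>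
          congr_hom (hm j) x }
  · have h1 : Hyp {z : Baire × Baire | z.1 ∈ DL ∧ z.2 ∈ DL ∧
        ∀ j, (sect (e j) z.1, sect (e j) z.2) ∈ EQ (δ j)} := by
      refine (hDL.preimage continuous_fst).and ((hDL.preimage continuous_snd).and
        (Hyp.forallCountable fun j => ?_))
      exact (hEQ j).preimage (f := fun z : Baire × Baire => (sect (e j) z.1, sect (e j) z.2))
        (by fun_prop)
    convert h1 using 1
    ext ⟨p, p'⟩
    have h2 : ∀ (hp : p ∈ DL) (hp' : p' ∈ DL) (j : J), (sect (e j) p, sect (e j) p') ∈ EQ (δ j) ↔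
        (δL ⟨p, hp⟩).val j = (δL ⟨p', hp'⟩).val j := fun hp hp' j =>
      mem_EQ ⟨sect (e j) p, hp.1 j⟩ ⟨sect (e j) p', hp'.1 j⟩
    constructor
    · rintro ⟨hp, hp', h⟩
      exact ⟨hp, hp', fun j => (h2 hp hp' j).2 (congrArg (fun x : L => x.val j) h)⟩
    · rintro ⟨hp, hp', h⟩
      exact ⟨hp, hp', CompatibleFamily.ext fun j => (h2 hp hp' j).1 (h j)⟩

end Limits

/-! ### Colimits -/

section Colimits

variable {J : Type} [SmallCategory J] (F : J ⥤ QCB0.{u})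

/-- The open subsets of the disjoint union of a diagram that are preimages of open sets of the
colimit. -/
structure IsInvariantOpen (V : Set (Σ j, (F.obj j).obj)) : Prop where
  isOpen : IsOpen V
  map : ∀ {i j : J} (f : i ⟶ j) (x : (F.obj i).obj), ⟨i, x⟩ ∈ V ↔ ⟨j, (F.map f).hom x⟩ ∈ V

/-- Points of the disjoint union of a diagram are identified in the colimit if no invariant open
set separates them. -/
def colimitSetoid : Setoid (Σ j, (F.obj j).obj) where
  r x y := ∀ V, IsInvariantOpen F V → (x ∈ V ↔ y ∈ V)
  iseqv := ⟨fun _ _ _ => Iff.rfl, fun h V hV => (h V hV).symm,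
    fun h h' V hV => (h V hV).trans (h' V hV)⟩

/-- The underlying space of the colimit of a diagram. -/
abbrev ColimitSpace : Type u := Quotient (colimitSetoid F)

variable {F}

/-- The inclusion of the disjoint union into the colimit. -/
abbrev toColimit (x : Σ j, (F.obj j).obj) : ColimitSpace F := Quotient.mk (colimitSetoid F) x

lemma continuous_toColimit : Continuous (toColimit (F := F)) := continuous_quot_mk

lemma toColimit_map {i j : J} (f : i ⟶ j) (x : (F.obj i).obj) :
    toColimit ⟨j, (F.map f).hom x⟩ = toColimit ⟨i, x⟩ :=
  Quotient.sound fun _ hV => (hV.map f x).symm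

lemma IsInvariantOpen.exists_eq {V : Set (Σ j, (F.obj j).obj)} (hV : IsInvariantOpen F V) :
    ∃ U : Set (ColimitSpace F), IsOpen U ∧ toColimit ⁻¹' U = V :=
  ⟨{x | Quotient.lift (s := colimitSetoid F) (· ∈ V) (fun _ _ h => propext (h V hV)) x},
    hV.isOpen, rfl⟩

instance : T0Space (ColimitSpace F) := by
  refine ⟨fun x y h => ?_⟩
  obtain ⟨x, rfl⟩ := Quotient.exists_rep x
  obtain ⟨y, rfl⟩ := Quotient.exists_rep y
  refine Quotient.sound fun V hV => ?_
  obtain ⟨U, hU, rfl⟩ := hV.exists_eq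
  exact inseparable_iff_forall_isOpen.1 h U hU

/-- Names from all the `D j`, tagged by a first digit `e j`, form one subspace of the Baire space;
the arrows of the diagram give the relation `R` to which `exists_isAdmissible_of_quotient` applies.
-/
theorem exists_isAdmissible_colimitSpace [CountableCategory J] (hF : ∀ j, HP (F.obj j)) :
    ∃ (D : Set Baire) (δ : D → ColimitSpace F), IsAdmissible δ ∧ Hyp (EQ δ) := by
  choose D δ hδ hEQ using fun j => HP_iff.1 (hF j)
  obtain ⟨e, he⟩ := exists_injective_nat J
  let DC : Set Baire := {p | ∃ j, p 0 = e j ∧ tail p ∈ D j}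
  have hzero : ∀ j, Hyp {p : Baire | p 0 = e j} := fun j => IsOpen.hyp
    ((isOpen_discrete ({e j} : Set ℕ)).preimage (f := fun p : Baire => p 0) (by fun_prop))
  have hDC : Hyp DC := Hyp.existsCountable fun j => (hzero j).and
    ((hyp_domain (hEQ j)).preimage continuous_tail)
  let R : Set (Baire × Baire) := {z | ∃ i j, ∃ f : i ⟶ j, z.1 0 = e i ∧ z.2 0 = e j ∧
    (tail z.1, tail z.2) ∈ nameRel (δ i) (δ j) (F.map f).hom}
  have hR : Hyp R := by
    refine Hyp.existsCountable fun i => Hyp.existsCountable fun j => Hyp.existsCountable fun f =>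
      ((hzero i).preimage continuous_fst).and (((hzero j).preimage continuous_snd).and ?_)
    exact (hyp_nameRel (hδ _) (hδ _) (hEQ _) (hEQ _) (QCB0.continuous (F.map f))).preimage
      (f := fun z : Baire × Baire => (tail z.1, tail z.2)) (by fun_prop)
  let q : DC → Σ j, (F.obj j).obj := fun p => ⟨p.2.choose, δ _ ⟨_, p.2.choose_spec.2⟩⟩
  have hq : ∀ (p : DC) (j : J) (_ : p.1 0 = e j) (h' : tail p ∈ D j),
      q p = ⟨j, δ j ⟨tail p, h'⟩⟩ := by
    intro p j h h'
    obtain rfl : p.2.choose = j := he (p.2.choose_spec.1.symm.trans h)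
    rfl
  have hmem : ∀ (p : DC) (j : J), p.1 0 = e j → tail p ∈ D j := by
    rintro ⟨p, i, h1, h2⟩ j h
    obtain rfl : i = j := he (h1.symm.trans h)
    exact h2
  have hqc : Continuous q := by
    refine continuous_iff_continuousAt.2 fun p => ?_
    obtain ⟨j, hj, -⟩ := id p.2
    have hO : IsOpen {p : DC | p.1 0 = e j} :=
      ((isOpen_discrete ({e j} : Set ℕ)).preimage (f := fun p : Baire => p 0)
        (by fun_prop)).preimage continuous_subtype_val
    refine ContinuousOn.continuousAt (s := {p : DC | p.1 0 = e j}) ?_ (hO.mem_nhds hj)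
    rw [continuousOn_iff_continuous_domRestrict]
    have : Set.domRestrict {p : DC | p.1 0 = e j} q =
        fun p => ⟨j, δ j ⟨tail p.1, hmem p.1 j p.2⟩⟩ := by
      ext1 p
      exact hq p.1 j p.2 _
    rw [this]
    refine continuous_sigmaMk.comp ((hδ j).continuous.comp ?_)
    fun_prop
  let c : ∀ j, D j → DC := fun j a => ⟨cons (e j) a, j, rfl, a.2⟩
  have hc : ∀ j, Continuous (c j) := fun j => by
    have := continuous_cons (e j)
    fun_prop
  have hqcons : ∀ j (a : D j), q (c j a) = ⟨j, δ j a⟩ := fun j a =>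
    hq (c j a) j rfl a.2
  have hcq : ∀ p : DC, ∃ j a, c j a = p := by
    rintro ⟨p, j, h1, h2⟩
    exact ⟨j, ⟨tail p, h2⟩, Subtype.ext (by simp only [c, ← h1]; exact cons_tail p)⟩
  have hcR : ∀ {i j : J} (f : i ⟶ j) (a : D i) (b : D j), (F.map f).hom (δ i a) = δ j b →
      ((c i a : Baire), (c j b : Baire)) ∈ R := fun {i j} f a b h =>
    ⟨i, j, f, rfl, rfl, (mem_nameRel a b).2 h⟩
  refine exists_isAdmissible_of_quotient (q := fun p => toColimit (q p)) hDC
    (continuous_toColimit.comp hqc) ?_ hR ?_ ?_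
  · intro x
    obtain ⟨⟨j, x⟩, rfl⟩ := Quotient.exists_rep x
    obtain ⟨a, rfl⟩ := (hδ j).surjective x
    exact ⟨c j a, congrArg _ (hqcons j a)⟩
  · rintro d d' ⟨i, j, f, hi, hj, hd, hd', h⟩
    rw [hq d i hi hd, hq d' j hj hd', ← h, toColimit_map]
  · intro V hV hVR
    -- One name in `V` is as good as all of them: identity arrows put any two names of the same
    -- point into `R`.
    let V' : Set (Σ j, (F.obj j).obj) := {s | ∃ a : D s.1, δ s.1 a = s.2 ∧ c s.1 a ∈ V}
    have hV' : ∀ j (a : D j), ⟨j, δ j a⟩ ∈ V' ↔ c j a ∈ V := by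
      refine fun j a => ⟨?_, fun h => ⟨a, rfl, h⟩⟩
      rintro ⟨b, hb, hbV⟩
      refine (hVR _ _ (hcR (𝟙 j) b a ?_)).1 hbV
      rw [F.map_id]
      exact hb
    have hinv : IsInvariantOpen F V' := by
      refine ⟨isOpen_sigma_iff.2 fun j => ?_, fun {i j} f x => ?_⟩
      · rw [← (hδ j).isQuotientMap.isOpen_preimage]
        convert hV.preimage (hc j) using 1
        ext a
        exact hV' j a
      · obtain ⟨a, rfl⟩ := (hδ i).surjective x
        obtain ⟨b, hb⟩ := (hδ j).surjective ((F.map f).hom (δ i a))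
        rw [← hb, hV', hV']
        exact hVR _ _ (hcR f a b hb.symm)
    obtain ⟨U, hU, hUV⟩ := hinv.exists_eq
    refine ⟨U, hU, ?_⟩
    ext p
    obtain ⟨j, a, rfl⟩ := hcq p
    rw [← hV', ← hUV, mem_preimage, mem_preimage, hqcons]

theorem exists_colimit [CountableCategory J] (hF : ∀ j, HP (F.obj j)) :
    ∃ c : Cocone F, Nonempty (IsColimit c) ∧ HP c.pt := by
  obtain ⟨D, δ, hδ, hEQ⟩ := exists_isAdmissible_colimitSpace hF
  let P : QCB0.{u} := ⟨TopCat.of (ColimitSpace F), isQCB0_of_isQuotientMap hδ.isQuotientMap⟩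
  let c : Cocone F :=
    { pt := P
      ι :=
        { app := fun j => mkHom (Y := P) (fun x => toColimit (F := F) ⟨j, x⟩)
            (continuous_toColimit.comp continuous_sigmaMk)
          naturality := fun i j f => QCB0.hom_ext fun x => toColimit_map f x } }
  refine ⟨c, ⟨?_⟩, HP_iff.2 ⟨D, δ, hδ, hEQ⟩⟩
  let d (s : Cocone F) (x : Σ j, (F.obj j).obj) : s.pt.obj := (s.ι.app x.1).hom x.2
  have hd : ∀ s, Continuous (d s) := fun s =>
    continuous_sigma_iff.2 fun j => QCB0.continuous (s.ι.app j)
  -- Preimages of open sets of the cocone point are invariant, so identified points have inseparable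
  -- images, and the target is `T₀`.
  have hs : ∀ (s : Cocone F) (x y : Σ j, (F.obj j).obj), colimitSetoid F x y → d s x = d s y := by
    intro s x y h
    refine (inseparable_iff_forall_isOpen.2 fun U hU => ?_).eq
    refine h (d s ⁻¹' U) ⟨hU.preimage (hd s), fun {i j} f x => ?_⟩
    rw [mem_preimage, mem_preimage,
      show d s ⟨j, (F.map f).hom x⟩ = d s ⟨i, x⟩ from congr_hom (s.w f) x]
  exact
    { desc := fun s => mkHom (X := P) (Quotient.lift (s := colimitSetoid F) (d s) (hs s))
        ((hd s).quotient_lift (hs s))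
      fac := fun s j => QCB0.hom_ext fun x => rfl
      uniq := fun s m hm => QCB0.hom_ext fun x => by
        obtain ⟨⟨j, x⟩, rfl⟩ := Quotient.exists_rep x
        exact congr_hom (hm j) x }

end Colimits

/-! ### Exponentials -/

theorem exists_isExponential (X Y : QCB0.{u}) (hX : HP X) (hY : HP Y) :
    ∃ E : QCB0.{u}, HP E ∧ IsExponential X Y E := by
  obtain ⟨A, δ, hδ, hδ'⟩ := HP_iff.1 hX
  obtain ⟨B, ε, hε, hε'⟩ := HP_iff.1 hY
  obtain ⟨E, _, app, happ, _, ⟨D, γ, hγ, hγ', hγq⟩, hE⟩ := exists_exponential hδ hε hδ' hε'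
  let E' : QCB0.{u} := ⟨TopCat.of E, isQCB0_of_isQuotientMap hγq⟩
  have hE' : HP E' := HP_iff.2 ⟨D, γ, hγ, hγ'⟩
  obtain ⟨P, ⟨hP⟩, -⟩ := exists_limit (pair E' X) (by rintro ⟨_ | _⟩ <;> assumption)
  let P : BinaryFan E' X := P
  have hev : Continuous fun t : P.pt.obj => app (P.fst.hom t) (P.snd.hom t) := by
    refine continuous_of_probe fun s hs => ?_
    obtain ⟨g, hg, hgs⟩ := hδ.lift IsEmbedding.id ((QCB0.continuous P.snd).comp hs)
    have h1 := (hE (fun b => P.fst.hom (s b))).1 ((QCB0.continuous P.fst).comp hs)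
    refine (h1.comp (continuous_id.prodMk hg)).congr fun b => ?_
    exact congrArg (app _) (hgs b).symm
  refine ⟨E', hE', P, ⟨hP⟩, mkHom _ hev, fun Z Q ⟨hQ⟩ g => ?_⟩
  have hQeq : ∀ {x y : Q.pt.obj}, Q.fst.hom x = Q.fst.hom y → Q.snd.hom x = Q.snd.hom y → x = y :=
    fun h h' => eq_of_isLimit hQ (by rintro ⟨_ | _⟩ <;> assumption)
  -- The slice of the product at `z`; composing it with `g` gives the transpose of `g` at `z`.
  let c (z : Z.obj) : X ⟶ Q.pt :=
    BinaryFan.IsLimit.lift hQ (mkHom (fun _ => z) continuous_const) (𝟙 X)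
  have hc1 : ∀ z x, Q.fst.hom ((c z).hom x) = z := fun z x =>
    congr_hom (BinaryFan.IsLimit.lift_fst hQ _ _) x
  have hc2 : ∀ z x, Q.snd.hom ((c z).hom x) = x := fun z x =>
    congr_hom (BinaryFan.IsLimit.lift_snd hQ _ _) x
  choose h hh using fun z => happ.2 ((c z ≫ g).hom.hom)
  have hh' : ∀ z x, app (h z) x = g.hom ((c z).hom x) := fun z x => by rw [hh]; rfl
  have hcont : Continuous h := by
    refine continuous_of_probe fun s hs => (hE _).2 ?_
    have : SecondCountableTopology (ULift.{u} (Baire × A)) :=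
      Homeomorph.ulift.secondCountableTopology
    have : T0Space (ULift.{u} (Baire × A)) := Homeomorph.ulift.isEmbedding.t0Space
    -- By `hE`, continuity along a probe `s` is joint continuity on `Baire × A`. This space is
    -- itself a qcb₀-space, so the universal property of `Q` provides the required continuous map
    -- into `Q.pt`.
    let W := ofSecondCountable (ULift.{u} (Baire × A))
    let a : W ⟶ Z := mkHom (fun w => s w.down.1)
      (hs.comp (continuous_fst.comp continuous_uliftDown))
    let b : W ⟶ X := mkHom (fun w => δ w.down.2)
      (hδ.continuous.comp (continuous_snd.comp continuous_uliftDown))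
    let l : W ⟶ Q.pt := BinaryFan.IsLimit.lift hQ a b
    have hl1 : ∀ w, Q.fst.hom (l.hom w) = a.hom w :=
      congr_hom (BinaryFan.IsLimit.lift_fst hQ _ _)
    have hl2 : ∀ w, Q.snd.hom (l.hom w) = b.hom w :=
      congr_hom (BinaryFan.IsLimit.lift_snd hQ _ _)
    have : (fun z : Baire × A => app (h (s z.1)) (δ z.2)) =
        fun z => g.hom (l.hom (ULift.up z)) := by
      ext1 z
      rw [hh']
      refine congrArg _ (hQeq ?_ ?_)
      · rw [hc1, hl1]; rfl
      · rw [hc2, hl2]; rfl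
    rw [this]
    exact (QCB0.continuous g).comp ((QCB0.continuous l).comp continuous_uliftUp)
  refine ⟨mkHom (Y := E') h hcont,
    ⟨BinaryFan.IsLimit.lift hP (Q.fst ≫ mkHom (Y := E') h hcont) Q.snd,
    BinaryFan.IsLimit.lift_fst hP _ _, BinaryFan.IsLimit.lift_snd hP _ _,
    QCB0.hom_ext fun t => ?_⟩, ?_⟩
  · have h1 := congr_hom (BinaryFan.IsLimit.lift_fst hP (Q.fst ≫ mkHom (Y := E') h hcont) Q.snd) t
    have h2 := congr_hom (BinaryFan.IsLimit.lift_snd hP (Q.fst ≫ mkHom (Y := E') h hcont) Q.snd) t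
    change app (P.fst.hom _) (P.snd.hom _) = _
    refine (congr_arg₂ (fun f x => app f x) h1 h2).trans ((hh' _ _).trans (congrArg _ (hQeq ?_ ?_)))
    · exact hc1 _ _
    · exact hc2 _ _
  · rintro h' ⟨k, hk1, hk2, hk⟩
    refine QCB0.hom_ext fun z => happ.1 (ContinuousMap.ext fun x => ?_)
    have h1 : P.fst.hom (k.hom ((c z).hom x)) = h'.hom z :=
      (congr_hom hk1 _).trans (congrArg h'.hom (hc1 z x))
    have h2 : P.snd.hom (k.hom ((c z).hom x)) = x := (congr_hom hk2 _).trans (hc2 z x)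
    have h3 : app (P.fst.hom (k.hom ((c z).hom x))) (P.snd.hom (k.hom ((c z).hom x))) =
      g.hom ((c z).hom x) := congr_hom hk _
    rw [h1, h2] at h3
    exact h3.trans (hh' z x).symm

/-! ### The Sierpinski space -/

/-- Every point of the Baire space is a name: `p` names truth when it codes the nonempty open subset
of the one-point space. -/
theorem containsSierpinski_HP : ContainsSierpinski HP.{u} := by
  have : SecondCountableTopology (ULift.{u} Prop) := Homeomorph.ulift.secondCountableTopology
  have : T0Space (ULift.{u} Prop) := Homeomorph.ulift.isEmbedding.t0Space
  refine ⟨ofSecondCountable (ULift.{u} Prop), HP_iff.2 ?_, ⟨Homeomorph.ulift⟩⟩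
  have hW := isOpen_openCode (B := Unit)
  let U : Set Baire := {p | (p, ()) ∈ openCode Unit}
  have hU : IsOpen U := hW.preimage (f := fun p : Baire => (p, ())) (by fun_prop)
  let δ : ↥(univ : Set Baire) → ULift.{u} Prop := fun p => ⟨p.1 ∈ U⟩
  have hfac : ∀ (Z : Set Baire) (ν : Z → ULift.{u} Prop), Continuous ν →
      ∃ g : Z → ↥(univ : Set Baire), Continuous g ∧ ∀ z, ν z = δ (g z) := by
    intro Z ν hν
    have hO : IsOpen {z : Z × ↥(univ : Set Unit) | (ν z.1).down} :=
      continuous_Prop.1 (continuous_uliftDown.comp (hν.comp continuous_fst))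
    obtain ⟨c, hc, hcW⟩ := exists_openCode hO
    exact ⟨fun z => ⟨c z, trivial⟩, by fun_prop, fun z =>
      ULift.ext _ _ (propext (hcW z ⟨(), trivial⟩).symm)⟩
  refine ⟨univ, δ, ⟨fun x => ?_, continuous_uliftUp.comp (continuous_Prop.2
    (hU.preimage continuous_subtype_val)), hfac⟩, ?_⟩
  · obtain ⟨g, -, hg⟩ := hfac univ (fun _ => x) continuous_const
    exact ⟨g ⟨0, trivial⟩, (hg _).symm⟩
  · have h1 : Hyp {z : Baire × Baire | z.1 ∈ U ↔ z.2 ∈ U} :=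
      (hU.hyp.preimage continuous_fst).iff (hU.hyp.preimage continuous_snd)
    convert h1 using 1
    ext ⟨p, p'⟩
    exact ⟨fun ⟨_, _, h⟩ => iff_of_eq (congrArg ULift.down h),
      fun h => ⟨trivial, trivial, ULift.ext _ _ (propext h)⟩⟩

theorem inheritsStructure_HP : InheritsStructure HP.{u} where
  exponentials := exists_isExponential
  limits _ _ _ F hF := exists_limit F hF
  colimits _ _ _ _ hF := exists_colimit hF

open QCB0

/-! ### Spaces with a homeomorphic copy in a full subcategory -/

/-- The space `X` has a homeomorphic copy in `S`. -/
def HasCopy (S : ObjectProperty QCB0.{u}) (X : Type v) [TopologicalSpace X] : Prop :=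
  ∃ Y : QCB0.{u}, S Y ∧ Nonempty (Y.obj ≃ₜ X)

/-- Isomorphic qcb₀-spaces are homeomorphic. -/
def QCB0.homeoOfIso {X Y : QCB0.{u}} (i : X ≅ Y) : X.obj ≃ₜ Y.obj :=
  TopCat.homeoOfIso (IsQCB0.{u}.ι.mapIso i)

/-- The binary product of second countable spaces. -/
abbrev prodFan (X Y : QCB0.{u}) [SecondCountableTopology X.obj] [SecondCountableTopology Y.obj] :
    BinaryFan X Y :=
  BinaryFan.mk (P := ofSecondCountable (X.obj × Y.obj)) (mkHom Prod.fst continuous_fst)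
    (mkHom Prod.snd continuous_snd)

/-- `prodFan X Y` is a product in the category of qcb₀-spaces. -/
def isLimitProdFan (X Y : QCB0.{u}) [SecondCountableTopology X.obj]
    [SecondCountableTopology Y.obj] : IsLimit (prodFan X Y) :=
  BinaryFan.isLimitMk
    (fun s => mkHom (X := s.pt) (Y := ofSecondCountable (X.obj × Y.obj))
      (fun x => (s.fst.hom x, s.snd.hom x))
      ((QCB0.continuous s.fst).prodMk (QCB0.continuous s.snd)))
    (fun _ => rfl) (fun _ => rfl)
    (fun _ _ h h' => QCB0.hom_ext fun x => Prod.ext (congr_hom h x) (congr_hom h' x))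

instance {ι : Type*} {X : ι → Type*} [∀ i, TopologicalSpace (X i)] [∀ i, T0Space (X i)] :
    T0Space (Σ i, X i) := by
  refine ⟨?_⟩
  rintro ⟨i, x⟩ ⟨j, y⟩ h
  obtain ⟨z, hz⟩ := (inseparable_iff_forall_isOpen.1 h _ isOpen_range_sigmaMk).1 ⟨x, rfl⟩
  obtain rfl : i = j := congrArg Sigma.fst hz
  rw [IsEmbedding.sigmaMk.isInducing.inseparable_iff] at h
  rw [h.eq]

namespace HasCopy

variable {S : ObjectProperty QCB0.{u}}

section Basic

variable {X : Type v} [TopologicalSpace X] {Y : Type w} [TopologicalSpace Y]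

lemma of_homeo (h : HasCopy S X) (e : X ≃ₜ Y) : HasCopy S Y := by
  obtain ⟨Z, hZ, ⟨f⟩⟩ := h
  exact ⟨Z, hZ, ⟨f.trans e⟩⟩

lemma of_preimage (e : X ≃ₜ Y) {A : Set Y} (h : HasCopy S (e ⁻¹' A)) : HasCopy S A :=
  h.of_homeo (e.subtype (p := (· ∈ e ⁻¹' A)) (q := (· ∈ A)) fun _ => Iff.rfl)

end Basic

/-! ### Copies obtained from countable limits and colimits -/

variable (hS : InheritsStructure S)
include hS

lemma of_isLimit {J : Type} [SmallCategory J] [CountableCategory J] {F : J ⥤ QCB0.{u}}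
    (hF : ∀ j, S (F.obj j)) {c : Cone F} (hc : IsLimit c) : HasCopy S c.pt.obj := by
  obtain ⟨c', ⟨hc'⟩, h⟩ := hS.limits J F hF
  exact ⟨c'.pt, h, ⟨QCB0.homeoOfIso (hc'.conePointUniqueUpToIso hc)⟩⟩

lemma of_isColimit {J : Type} [SmallCategory J] [CountableCategory J] {F : J ⥤ QCB0.{u}}
    (hF : ∀ j, S (F.obj j)) {c : Cocone F} (hc : IsColimit c) : HasCopy S c.pt.obj := by
  obtain ⟨c', ⟨hc'⟩, h⟩ := hS.colimits J F hF
  exact ⟨c'.pt, h, ⟨QCB0.homeoOfIso (hc'.coconePointUniqueUpToIso hc)⟩⟩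

/-- Second countability passes to subspaces, so the subspace topology is already the topology of the
equalizer in `QCB0`. -/
lemma equalizer {X Z : QCB0.{u}} [SecondCountableTopology X.obj] (hX : S X) (hZ : S Z)
    (f g : X ⟶ Z) : HasCopy S {x : X.obj | f.hom x = g.hom x} := by
  let E := ofSecondCountable {x : X.obj | f.hom x = g.hom x}
  let i : E ⟶ X := mkHom (X := E) Subtype.val continuous_subtype_val
  let c : Fork f g := Fork.ofι (P := E) i (QCB0.hom_ext fun x => x.2)
  have hc : IsLimit c := Fork.IsLimit.mk _
    (fun s => mkHom (Y := E) (fun x => ⟨s.ι.hom x, congr_hom s.condition x⟩)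
      ((QCB0.continuous s.ι).subtype_mk _))
    (fun s => rfl)
    (fun s m hm => QCB0.hom_ext fun x => Subtype.ext (congr_hom hm x))
  exact of_isLimit hS (by rintro (_ | _) <;> assumption) hc

lemma prod {X : Type v} [TopologicalSpace X] [SecondCountableTopology X] {Y : Type w}
    [TopologicalSpace Y] [SecondCountableTopology Y] (hX : HasCopy S X) (hY : HasCopy S Y) :
    HasCopy S (X × Y) := by
  obtain ⟨X', hX', ⟨e⟩⟩ := hX
  obtain ⟨Y', hY', ⟨f⟩⟩ := hY
  have := e.secondCountableTopology
  have := f.secondCountableTopology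
  exact (of_isLimit hS (by rintro ⟨_ | _⟩ <;> assumption) (isLimitProdFan X' Y')).of_homeo
    (e.prodCongr f)

lemma pi {ι : Type} [Countable ι] {X : ι → Type v} [∀ i, TopologicalSpace (X i)]
    [∀ i, SecondCountableTopology (X i)] (hX : ∀ i, HasCopy S (X i)) : HasCopy S (∀ i, X i) := by
  choose Y hY e using hX
  have e := fun i => (e i).some
  have := fun i => (e i).secondCountableTopology
  let P := ofSecondCountable (∀ i, (Y i).obj)
  let c : Fan Y := Fan.mk P fun i => mkHom (X := P) (fun x => x i) (continuous_apply i)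
  have hc : IsLimit c := Fan.IsLimit.mk _
    (fun s => mkHom (Y := P) (fun x i => (s.proj i).hom x)
      (continuous_pi fun i => QCB0.continuous (s.proj i)))
    (fun s i => rfl)
    (fun s m hm => QCB0.hom_ext fun x => funext fun i => congr_hom (hm i) x)
  exact (of_isLimit hS (fun i => hY i.as) hc).of_homeo (Homeomorph.piCongrRight e)

lemma sigma {ι : Type} [Countable ι] {X : ι → Type v} [∀ i, TopologicalSpace (X i)]
    [∀ i, SecondCountableTopology (X i)] (hX : ∀ i, HasCopy S (X i)) :
    HasCopy S (Σ i, X i) := by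
  choose Y hY e using hX
  have e := fun i => (e i).some
  have := fun i => (e i).secondCountableTopology
  let P := ofSecondCountable (Σ i, (Y i).obj)
  have hmk : ∀ i, Continuous fun x : (Y i).obj => (⟨i, x⟩ : Σ i, (Y i).obj) := fun i =>
    continuous_sigmaMk (σ := fun i => (Y i).obj) (i := i)
  let c : Cofan Y := Cofan.mk P fun i => mkHom (X := Y i) (Y := P) _ (hmk i)
  have hc : IsColimit c := Cofan.IsColimit.mk _
    (fun s => mkHom (X := P) (fun x => (s.inj x.1).hom x.2)
      (continuous_sigma_iff.2 fun i => QCB0.continuous (s.inj i)))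
    (fun s i => rfl)
    (fun s m hm => QCB0.hom_ext fun x => congr_hom (hm x.1) x.2)
  refine (of_isColimit hS (fun i => hY i.as) hc).of_homeo ?_
  exact
    { Equiv.sigmaCongrRight fun i => (e i).toEquiv with
      continuous_toFun := Continuous.sigma_map fun i => (e i).continuous
      continuous_invFun := continuous_sigma_iff.2 fun i => (hmk i).comp (e i).symm.continuous }

lemma punit : HasCopy S PUnit.{v + 1} :=
  (pi hS (ι := Empty) (X := fun _ => PUnit.{v + 1}) (fun i => i.elim)).of_homeo
    (Homeomorph.homeomorphOfUnique _ _)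

lemma nat : HasCopy S ℕ :=
  (sigma hS (ι := ℕ) (X := fun _ => PUnit.{1}) fun _ => punit hS).of_homeo
    ((Equiv.sigmaPUnit ℕ).toHomeomorph fun s => by simp)

lemma baire : HasCopy S Baire := pi hS fun _ => nat hS

/-! ### Open sets, images and complements via the Sierpinski space -/

variable (hSier : ContainsSierpinski S)
include hSier

lemma of_isOpen {X : Type v} [TopologicalSpace X] [SecondCountableTopology X] (hX : HasCopy S X)
    {U : Set X} (hU : IsOpen U) : HasCopy S U := by
  obtain ⟨X', hX', ⟨e⟩⟩ := hX
  obtain ⟨Z, hZ, ⟨σ⟩⟩ := hSier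
  have := e.secondCountableTopology
  let f : X' ⟶ Z := mkHom (fun x => σ.symm (e x ∈ U))
    (σ.symm.continuous.comp (continuous_Prop.2 (hU.preimage e.continuous)))
  let g : X' ⟶ Z := mkHom (fun _ => σ.symm True) continuous_const
  refine of_preimage e ?_
  have h : {x : X'.obj | f.hom x = g.hom x} = e ⁻¹' U := by
    ext x
    exact σ.symm.injective.eq_iff.trans (by simp)
  exact h ▸ equalizer hS hX' hZ f g

/-- The range is the equalizer of the cokernel pair of `f`. A point `x` outside it is separated by
the constant map `True` and the characteristic map of the complement of `x`, open as points are
closed: they agree on the range, hence factor through the pushout, but differ at `x`. As an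
equalizer, the range carries the subspace topology of `X`. -/
lemma range {X : Type v} [TopologicalSpace X] [SecondCountableTopology X] [T2Space X]
    {B : Type w} [TopologicalSpace B] (hX : HasCopy S X) (hB : HasCopy S B) {f : B → X}
    (hf : Continuous f) : HasCopy S (Set.range f) := by
  obtain ⟨X', hX', ⟨e⟩⟩ := hX
  obtain ⟨B', hB', ⟨b⟩⟩ := hB
  obtain ⟨Z, hZ, ⟨σ⟩⟩ := hSier
  have := e.secondCountableTopology
  let f' : B' ⟶ X' := mkHom (fun x => e.symm (f (b x)))
    (e.symm.continuous.comp (hf.comp b.continuous))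
  obtain ⟨c, ⟨hc⟩, hcS⟩ := hS.colimits _ (span f' f') (by rintro (_ | _ | _) <;> assumption)
  let c : PushoutCocone f' f' := c
  refine of_preimage e ?_
  have h : {x : X'.obj | c.inl.hom x = c.inr.hom x} = e ⁻¹' Set.range f := by
    ext x
    constructor
    · intro hx
      by_contra hxf
      let u : X' ⟶ Z := mkHom (fun _ => σ.symm True) continuous_const
      let v : X' ⟶ Z := mkHom (fun y => σ.symm (e y ≠ e x)) (σ.symm.continuous.comp
        (continuous_Prop.2 (isOpen_ne.preimage e.continuous)))
      have huv : f' ≫ u = f' ≫ v := QCB0.hom_ext fun y => congrArg σ.symm <| by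
        refine (eq_true fun h => hxf ⟨b y, ?_⟩).symm
        exact (e.apply_symm_apply _).symm.trans h
      have h1 := congr_hom (PushoutCocone.IsColimit.inl_desc hc u v huv) x
      have h2 := congr_hom (PushoutCocone.IsColimit.inr_desc hc u v huv) x
      have h3 : u.hom x = v.hom x := h1.symm.trans
        ((congrArg (PushoutCocone.IsColimit.desc hc u v huv).hom hx).trans h2)
      have h4 : True = (e x ≠ e x) := σ.symm.injective h3
      exact (h4 ▸ trivial : e x ≠ e x) rfl
    · rintro ⟨y, hy⟩
      have h1 := congr_hom c.condition (b.symm y)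
      have h2 : f'.hom (b.symm y) = x := by
        change e.symm (f (b (b.symm y))) = x
        rw [b.apply_symm_apply, hy, e.symm_apply_apply]
      exact (congrArg c.inl.hom h2.symm).trans (h1.trans (congrArg c.inr.hom h2))
  exact h ▸ equalizer hS hX' hcS c.inl c.inr

/-- Since `X` is Hausdorff, `(x, a) ↦ (x ≠ a)` is continuous into the Sierpinski space. Its
transpose agrees at `x` with that of the constant `True` exactly when `x` differs from every point
of `A`. -/
lemma compl {X : Type v} [TopologicalSpace X] [SecondCountableTopology X] [T2Space X]
    {A : Set X} (hX : HasCopy S X) (hA : HasCopy S A) : HasCopy S ↥Aᶜ := by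
  obtain ⟨X', hX', ⟨e⟩⟩ := hX
  obtain ⟨A', hA', ⟨a⟩⟩ := hA
  obtain ⟨Z, hZ, ⟨σ⟩⟩ := hSier
  have := e.secondCountableTopology
  have := a.secondCountableTopology
  obtain ⟨E, hE, P, ⟨hP⟩, ev, hev⟩ := hS.exponentials A' Z hA' hZ
  let Q := prodFan X' A'
  let g : Q.pt ⟶ Z := mkHom (X := ofSecondCountable (X'.obj × A'.obj))
    (fun x => σ.symm (e x.1 ≠ a x.2)) (σ.symm.continuous.comp (continuous_Prop.2
      (isOpen_ne_fun (e.continuous.comp continuous_fst)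
        (continuous_subtype_val.comp (a.continuous.comp continuous_snd)))))
  let t (W : QCB0.{u}) : W ⟶ Z := mkHom (fun _ => σ.symm True) continuous_const
  obtain ⟨h, ⟨k, hk1, hk2, hk⟩, -⟩ := hev X' Q ⟨isLimitProdFan X' A'⟩ g
  obtain ⟨h', ⟨k', hk1', hk2', hk'⟩, -⟩ := hev X' Q ⟨isLimitProdFan X' A'⟩ (t _)
  refine of_preimage e ?_
  have key : {x : X'.obj | h.hom x = h'.hom x} = e ⁻¹' Aᶜ := by
    ext x
    constructor
    · intro hx hxA
      let q : Q.pt.obj := (x, a.symm ⟨e x, hxA⟩)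
      have h1 : k.hom q = k'.hom q := by
        refine eq_of_isLimit hP ?_
        rintro ⟨_ | _⟩
        · exact (congr_hom hk1 q).trans (hx.trans (congr_hom hk1' q).symm)
        · exact (congr_hom hk2 q).trans (congr_hom hk2' q).symm
      have h2 : g.hom q = (t Q.pt).hom q := (congr_hom hk q).symm.trans
        ((congrArg ev.hom h1).trans (congr_hom hk' q))
      have h3 : (e x ≠ a (a.symm ⟨e x, hxA⟩)) = True := σ.symm.injective h2
      simp at h3
    · intro hx
      -- Restricted to the complement, both maps are transposes of the constant `True`, so
      -- uniqueness identifies them.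
      let C := ofSecondCountable (e ⁻¹' Aᶜ)
      let i : C ⟶ X' := mkHom (X := C) Subtype.val continuous_subtype_val
      let m : (prodFan C A').pt ⟶ Q.pt := mkHom (X := ofSecondCountable (C.obj × A'.obj))
        (Y := ofSecondCountable (X'.obj × A'.obj)) (Prod.map Subtype.val id)
        (continuous_subtype_val.prodMap continuous_id)
      have hg : m ≫ g = t _ := QCB0.hom_ext fun z => congrArg σ.symm <|
        eq_true fun h => z.1.2 (h ▸ (a z.2).2)
      have heq : i ≫ h = i ≫ h' := (hev C (prodFan C A') ⟨isLimitProdFan C A'⟩ (t _)).unique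
        ⟨m ≫ k, by rw [Category.assoc, hk1]; rfl, by rw [Category.assoc, hk2]; rfl, by
          rw [Category.assoc, hk, hg]⟩
        ⟨m ≫ k', by rw [Category.assoc, hk1']; rfl, by rw [Category.assoc, hk2']; rfl, by
          rw [Category.assoc, hk']; rfl⟩
      exact congr_hom heq ⟨x, hx⟩
  exact key ▸ equalizer hS hX' hE h h'

/-! ### Copies of all sets in the hierarchy -/

section Pointclass

variable {X : Type} [TopologicalSpace X] [SecondCountableTopology X] [T2Space X]

lemma iUnion {ι : Type} [Countable ι] (hX : HasCopy S X) {A : ι → Set X}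
    (hA : ∀ i, HasCopy S (A i)) : HasCopy S ↥(⋃ i, A i) := by
  have h : Set.range (fun x : Σ i, A i => (x.2 : X)) = ⋃ i, A i := by
    ext; simp
  exact h ▸ range hS hSier hX (sigma hS hA)
    (continuous_sigma_iff.2 fun i => continuous_subtype_val)

lemma iInter {ι : Type} [Countable ι] (hX : HasCopy S X) {A : ι → Set X}
    (hA : ∀ i, HasCopy S (A i)) : HasCopy S ↥(⋂ i, A i) := by
  rw [← compl_compl (⋂ i, A i), compl_iInter]
  exact compl hS hSier hX (iUnion hS hSier hX fun i => compl hS hSier hX (hA i))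

/-- Projections are ranges, and the remaining operations are complements and countable Boolean
combinations. The ambient space varies in the induction because each step passes to `Baire × X`. -/
lemma of_mem_sigmaOne (α : Ordinal.{0}) : ∀ (X : Type) [TopologicalSpace X]
    [SecondCountableTopology X] [T2Space X], HasCopy S X → ∀ A ∈ PointclassFamily.sigmaOne α X,
      HasCopy S A := by
  have proj : ∀ {X : Type} [TopologicalSpace X] [SecondCountableTopology X] [T2Space X],
      HasCopy S X → ∀ B : Set (Baire × X), HasCopy S B →
        HasCopy S {x | ∃ p, (p, x) ∈ B} := by
    intro X _ _ _ hX B hB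
    have h : Set.range (fun z : B => z.1.2) = {x | ∃ p, (p, x) ∈ B} := by
      ext; simp
    exact h ▸ range hS hSier hX hB (continuous_snd.comp continuous_subtype_val)
  induction α using Ordinal.limitRecOn with
  | zero =>
    rw [sigmaOne_zero]
    rintro X _ _ _ hX _ ⟨B, hB, rfl⟩
    refine iUnion hS hSier hX fun n => ?_
    obtain ⟨U, hU, V, hV, h⟩ := hB n
    rw [h, sdiff_eq, inter_eq_iInter]
    refine iInter hS hSier hX ?_
    rintro (_ | _)
    · exact compl hS hSier hX (of_isOpen hS hSier hX hV)
    · exact of_isOpen hS hSier hX hU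
  | add_one α ih =>
    rw [sigmaOne_add_one]
    rintro X _ _ _ hX _ ⟨_, ⟨B, hB, rfl⟩, rfl⟩
    have hNX := prod hS (baire hS) hX
    exact proj hX _ (compl hS hSier hNX (ih _ hNX B hB))
  | limit γ hγ ih =>
    rw [sigmaOne_limit hγ]
    rintro X _ _ _ hX _ ⟨_, ⟨B, hB, rfl⟩, rfl⟩
    have hNX := prod hS (baire hS) hX
    refine proj hX _ (iInter hS hSier hNX fun n => ?_)
    obtain ⟨β, hβ, h⟩ := hB n
    exact ih β hβ _ hNX _ h

end Pointclass

/-- As `X` is sequential, `δ` is a quotient map, so `X` is the coequalizer of the two projections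
from `EQ δ` to `D`; both of these spaces have copies in `S`. -/
theorem of_HP {X : QCB0.{u}} (hX : HP X) : HasCopy S X.obj := by
  obtain ⟨α, -, D, δ, hδ, hEQ⟩ := hX
  have hB := baire hS
  have hEQ' := of_mem_sigmaOne hS hSier α _ (prod hS hB hB) _ hEQ
  have hD : HasCopy S D := by
    -- The relation is reflexive on `D`, so its first projection is all of `D`.
    have h : Set.range (fun z : EQ δ => z.1.1) = D := by
      ext p
      simp only [Set.mem_range]
      exact ⟨fun ⟨z, hz⟩ => hz ▸ z.2.1, fun hp => ⟨⟨(p, p), hp, hp, rfl⟩, rfl⟩⟩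
    exact h ▸ range hS hSier hB hEQ' (continuous_fst.comp continuous_subtype_val)
  obtain ⟨K, hK, ⟨k⟩⟩ := hEQ'
  obtain ⟨D', hD', ⟨d⟩⟩ := hD
  let p : K ⟶ D' := mkHom (fun z => d.symm ⟨(k z).1.1, (k z).2.1⟩)
    (d.symm.continuous.comp ((continuous_fst.comp
      (continuous_subtype_val.comp k.continuous)).subtype_mk _))
  let q : K ⟶ D' := mkHom (fun z => d.symm ⟨(k z).1.2, (k z).2.2.1⟩)
    (d.symm.continuous.comp ((continuous_snd.comp
      (continuous_subtype_val.comp k.continuous)).subtype_mk _))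
  let π : D' ⟶ X := mkHom (fun x => δ (d x)) (hδ.continuous.comp d.continuous)
  let c : Cofork p q := Cofork.ofπ π (QCB0.hom_ext fun z => by
    change δ (d (d.symm _)) = δ (d (d.symm _))
    rw [d.apply_symm_apply, d.apply_symm_apply]
    exact (k z).2.2.2)
  have hs : ∀ (s : Cofork p q) (x y : D), δ x = δ y →
      s.π.hom (d.symm x) = s.π.hom (d.symm y) := by
    intro s x y h
    have := congr_hom s.condition (k.symm ⟨(x, y), (mem_EQ x y).2 h⟩)
    change s.π.hom (d.symm ⟨(k (k.symm _)).1.1, _⟩) =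
      s.π.hom (d.symm ⟨(k (k.symm _)).1.2, _⟩) at this
    simpa only [k.apply_symm_apply] using this
  have hdesc : ∀ (s : Cofork p q) (x : D),
      s.π.hom (d.symm (Function.surjInv hδ.surjective (δ x))) = s.π.hom (d.symm x) :=
    fun s x => hs s _ _ (Function.surjInv_eq _ _)
  have hc : IsColimit c := Cofork.IsColimit.mk _
    (fun s => mkHom (fun x => s.π.hom (d.symm (Function.surjInv hδ.surjective x)))
      (hδ.isQuotientMap.continuous_iff.2 (((QCB0.continuous s.π).comp d.symm.continuous).congr
        fun x => (hdesc s x).symm)))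
    (fun s => QCB0.hom_ext fun x => (hdesc s (d x)).trans
      (congrArg s.π.hom (d.symm_apply_apply x)))
    (fun s m hm => QCB0.hom_ext fun x => by
      obtain ⟨y, rfl⟩ := hδ.surjective x
      refine Eq.trans ?_ (hdesc s y).symm
      rw [← congr_hom hm (d.symm y)]
      exact congrArg (fun z => m.hom (δ z)) (d.apply_symm_apply y).symm)
  exact of_isColimit hS (by rintro (_ | _) <;> assumption) hc

end HasCopy

end HyperprojectiveQCB

end

theorem theorem7p2 :
    (HyperprojectiveQCB.ContainsSierpinski HyperprojectiveQCB.HP.{u} ∧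
      HyperprojectiveQCB.InheritsStructure HyperprojectiveQCB.HP.{u}) ∧
    ∀ S : ObjectProperty HyperprojectiveQCB.QCB0.{u},
      HyperprojectiveQCB.ContainsSierpinski S →
      HyperprojectiveQCB.InheritsStructure S →
      ∀ X : HyperprojectiveQCB.QCB0.{u}, HyperprojectiveQCB.HP X →
        ∃ Y : HyperprojectiveQCB.QCB0.{u}, S Y ∧ Nonempty (X.obj ≃ₜ Y.obj) := by
  refine ⟨⟨HyperprojectiveQCB.containsSierpinski_HP, HyperprojectiveQCB.inheritsStructure_HP⟩,
    fun S hSier hS X hX => ?_⟩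
  obtain ⟨Y, hY, ⟨e⟩⟩ := HyperprojectiveQCB.HasCopy.of_HP hS hSier hX
  exact ⟨Y, hY, ⟨e.symm⟩⟩
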